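/- **Setting.** All matrices are real; a square matrix is *Schur stable* if all its eigenvalues lie in the open unit disc. Let $\{(C_t,A_t,B_t,C_t^m)\}_{t\in\mathcal T}$ be a finite family of models of discrete-time introspective agents $$x(k+1)=A_tx(k)+B_tu(k),\qquad y(k)=C_tx(k)\in\mathbb R^p,\qquad z(k)=C_t^mx(k),$$ such that for every $t$ the pair $(A_t,B_t)$ is stabilizable, $(C_t,A_t)$ and $(C_t^m,A_t)$ are detectable, and $(C_t,A_t,B_t)$ is right-invertible. Let $x_r(k+1)=A_rx_r(k)$, $y_r(k)=C_rx_r(k)\in\mathbb R^p$ be an exosystem with $(C_r,A_r)$ observable and all eigenvalues of $A_r$ on the unit circle. **Network.** A network consists of any number $N$ of agents, each with a model from the family, a weighted directed graph on $\{1,\dots,N\}$ with weights $a_{ij}\ge 0$, $a_{ii}=0$ ($a_{ij}>0$ meaning an edge from $j$ to $i$), which is a directed spanning tree with root $1$ and lower triangular Laplacian (so $a_{ij}>0$ only if $j<i$, and each $i\ne1$ has exactly one parent), and arbitrary delays $\kappa_{ij},\hat\kappa_{ij},\kappa_{1r}\in\mathbb N$. Let $d_{in}(i)=\sum_ja_{ij}$,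 $\iota_1=1$, $\iota_i=0$ for $i\neq1$, and let $\kappa_{ir}$ be the sum of $\kappa_{1r}$ and of the delays $\kappa$ along the path from the root to $i$, i.e. $\kappa_{ir}=\kappa_{ij}+\kappa_{jr}$ if $a_{ij}>0$. Agent $i$ receives $$\bar\zeta_i(k)=\tfrac1{2+d_{in}(i)}\Big[\sum_ja_{ij}\big(y_i(k)-y_j(k-\kappa_{ij})\big)+\iota_i\big(y_i(k)-y_r(k-\kappa_{1r})\big)\Big],$$ $$\hat\zeta_i(k)=\tfrac1{2+d_{in}(i)}\Big[\sum_ja_{ij}\big(\xi_i(k)-\xi_j(k-\hat\kappa_{ij})\big)+\iota_i\,\xi_i(k)\Big],$$ where $\xi_i$ is a variable produced and transmitted by the protocol of agent $i$. **Problem.** Find for each model $t$ a linear dynamic protocol $$x_c(k+1)=\mathsf A_tx_c+\mathsf B_t\bar\zeta+\mathsf C_t\hat\zeta+\mathsf D_tz,\qquad u=\mathsf E_tx_c+\mathsf F_t\bar\zeta+\mathsf G_t\hat\zeta+\mathsf H_tz,\qquad \xi=\mathsf X_tx_c,$$ which depends only on the exosystem and the family of agent models, such that in every network as above (any $N$,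 any assignment of models, any such tree, any delays) and for all initial data (all initial states, and arbitrary values of the delayed signals at negative times) delayed regulated output synchronization is achieved: $\lim_{k\to\infty}[y_i(k)-y_r(k-\kappa_{ir})]=0$ for all $i$. **Theorem.** This problem is solvable. In particular, it is solved by the protocol obtained in the following steps, all of which can be carried out: 0. There is an integer $n_q\ge1$ which is at least the order of every infinite zero of every $(C_t,A_t,B_t)$ and at least all observability indices of $(C_r,A_r)$. Fix any such $n_q$. 1. There is a target model $(\check C_r,\check A_r,\check B_r)$ which is invertible, of uniform rank $n_q$, without invariant zeros, such that $\check x_r(k+1)=\check A_r\check x_r(k)$, $y=\check C_r\check x_r$ generates every output $y_r$ of the exosystem, and such that the eigenvalues of $\check A_r$ are those of $A_r$ and additional zeros (with multiplicity). Fix any such model. 2. For every $t$ there is a pre-compensator $\xi^h(k+1)=A_{t,h}\xi^h+B_{t,h}z+E_{t,h}v$, $u=C_{t,h}\xi^h+D_{t,h}v$ that homogenizes the agent: there are a Schur stable $A_{t,s}$ and a matrix $C_{t,s}$ such that for every input $v$ and all initial states the output of the compensated agent satisfies $y=\check C_rx^h$, $x^h(k+1)=\check A_rx^h+\check B_r(v+\rho)$,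 $\rho=C_{t,s}\omega$, $\omega(k+1)=A_{t,s}\omega$ for some $x^h,\omega$. Fix any such pre-compensators. 3. There are matrices $H$ and $K$ such that $\check A_r-H\check C_r$ and $\check A_r-\check B_rK$ are Schur stable. Fix any such matrices. 4. For any such choices, the protocol with state $(\xi^h_i,\hat x_i,\chi_i)$, transmitted variable $\xi_i=\chi_i$, and $$\begin{aligned}\xi^h_i(k+1)&=A_{i,h}\xi^h_i(k)+B_{i,h}z_i(k)-E_{i,h}K\chi_i(k),\\ \hat x_i(k+1)&=\check A_r\hat x_i(k)-\check B_rK\hat\zeta_i(k)+H(\bar\zeta_i(k)-\check C_r\hat x_i(k)),\\ \chi_i(k+1)&=(\check A_r-\check B_rK)\chi_i(k)+\check A_r\hat x_i(k)-\check A_r\hat\zeta_i(k),\\ u_i(k)&=C_{i,h}\xi^h_i(k)-D_{i,h}K\chi_i(k)\end{aligned}$$ (with the pre-compensator matrices of the model of agent $i$) solves the problem. -/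

import Mathlib

open Filter Topology
open scoped Matrix

noncomputable section

namespace DelayedSync

/-! ### Linear systems -/

/-- Schur stability: all (complex) eigenvalues lie in the open unit disc. -/
def IsSchur {n : ℕ} (A : Matrix (Fin n) (Fin n) ℝ) : Prop :=
  ∀ z ∈ spectrum ℂ (A.map (algebraMap ℝ ℂ)), ‖z‖ < 1

/-- All (complex) eigenvalues lie on the unit circle. -/
def EigenvaluesOnUnitCircle {n : ℕ} (A : Matrix (Fin n) (Fin n) ℝ) : Prop :=
  ∀ z ∈ spectrum ℂ (A.map (algebraMap ℝ ℂ)), ‖z‖ = 1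

/-- `(A, B)` is stabilizable: some state feedback makes it Schur stable. -/
def Stabilizable {n m : ℕ} (A : Matrix (Fin n) (Fin n) ℝ) (B : Matrix (Fin n) (Fin m) ℝ) : Prop :=
  ∃ F : Matrix (Fin m) (Fin n) ℝ, IsSchur (A - B * F)

/-- `(C, A)` is detectable: some output injection makes it Schur stable. -/
def Detectable {n q : ℕ} (C : Matrix (Fin q) (Fin n) ℝ) (A : Matrix (Fin n) (Fin n) ℝ) : Prop :=
  ∃ L : Matrix (Fin n) (Fin q) ℝ, IsSchur (A - L * C)

/-- The first `k` samples `C x, C A x, …, C A ^ (k - 1) x` of the free output determine the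
initial state `x`. -/
def ObservableIn {n p : ℕ} (C : Matrix (Fin p) (Fin n) ℝ) (A : Matrix (Fin n) (Fin n) ℝ)
    (k : ℕ) : Prop :=
  ∀ x : Fin n → ℝ, (∀ l < k, (C * A ^ l) *ᵥ x = 0) → x = 0

/-- `(C, A)` is observable. -/
def Observable {n p : ℕ} (C : Matrix (Fin p) (Fin n) ℝ) (A : Matrix (Fin n) (Fin n) ℝ) : Prop :=
  ∀ x : Fin n → ℝ, (∀ l : ℕ, (C * A ^ l) *ᵥ x = 0) → x = 0

/-- The observability index of an observable pair, that is, the largest of its observability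
indices: the least `k` for which the observability matrix with `k` block rows has full
column rank. -/
def observabilityIndex {n p : ℕ} (C : Matrix (Fin p) (Fin n) ℝ)
    (A : Matrix (Fin n) (Fin n) ℝ) : ℕ :=
  sInf {k : ℕ | ObservableIn C A k}

/-- The transfer matrix `C (z I - A)⁻¹ B` over the field of real rational functions of `z`. -/
def transferMatrix {n m p : ℕ} (C : Matrix (Fin p) (Fin n) ℝ) (A : Matrix (Fin n) (Fin n) ℝ)
    (B : Matrix (Fin n) (Fin m) ℝ) : Matrix (Fin p) (Fin m) (RatFunc ℝ) :=
  C.map (algebraMap ℝ (RatFunc ℝ)) *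
    (Matrix.scalar (Fin n) (RatFunc.X : RatFunc ℝ) - A.map (algebraMap ℝ (RatFunc ℝ)))⁻¹ *
    B.map (algebraMap ℝ (RatFunc ℝ))

/-- Right-invertibility: the transfer matrix has a rational right inverse. -/
def RightInvertible {n m p : ℕ} (C : Matrix (Fin p) (Fin n) ℝ) (A : Matrix (Fin n) (Fin n) ℝ)
    (B : Matrix (Fin n) (Fin m) ℝ) : Prop :=
  ∃ R : Matrix (Fin m) (Fin p) (RatFunc ℝ), transferMatrix C A B * R = 1

/-- Left-invertibility: the transfer matrix has a rational left inverse. -/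
def LeftInvertible {n m p : ℕ} (C : Matrix (Fin p) (Fin n) ℝ) (A : Matrix (Fin n) (Fin n) ℝ)
    (B : Matrix (Fin n) (Fin m) ℝ) : Prop :=
  ∃ R : Matrix (Fin m) (Fin p) (RatFunc ℝ), R * transferMatrix C A B = 1

/-- The expansion at infinity `∑ C A ^ k B w ^ (k + 1)` of the transfer matrix, `w = z⁻¹`. -/
def expansionAtInfinity {n m p : ℕ} (C : Matrix (Fin p) (Fin n) ℝ)
    (A : Matrix (Fin n) (Fin n) ℝ) (B : Matrix (Fin n) (Fin m) ℝ) :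
    Matrix (Fin p) (Fin m) (PowerSeries ℝ) :=
  Matrix.of fun i j => PowerSeries.X * PowerSeries.mk fun k => (C * A ^ k * B) i j

/-- The system has an infinite zero of order `q`: the monomial `w ^ q`, `w = z⁻¹`, occurs on the
diagonal of the Smith (McMillan) form of the transfer matrix at infinity. -/
def HasInfiniteZero {n m p : ℕ} (C : Matrix (Fin p) (Fin n) ℝ) (A : Matrix (Fin n) (Fin n) ℝ)
    (B : Matrix (Fin n) (Fin m) ℝ) (q : ℕ) : Prop :=
  ∃ (U : Matrix (Fin p) (Fin p) (PowerSeries ℝ)) (V : Matrix (Fin m) (Fin m) (PowerSeries ℝ))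
    (S : Matrix (Fin p) (Fin m) (PowerSeries ℝ)),
    IsUnit U ∧ IsUnit V ∧ U * expansionAtInfinity C A B * V = S ∧
    (∀ i j, i.val ≠ j.val → S i j = 0) ∧
    (∀ i j, i.val = j.val → S i j = 0 ∨ ∃ e : ℕ, S i j = PowerSeries.X ^ e) ∧
    ∃ i j, i.val = j.val ∧ S i j = PowerSeries.X ^ q

/-- The Rosenbrock system matrix at the complex number `z`. -/
def systemMatrix {n m p : ℕ} (C : Matrix (Fin p) (Fin n) ℝ) (A : Matrix (Fin n) (Fin n) ℝ)
    (B : Matrix (Fin n) (Fin m) ℝ) (z : ℂ) : Matrix (Fin n ⊕ Fin p) (Fin n ⊕ Fin m) ℂ :=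
  Matrix.fromBlocks (Matrix.scalar (Fin n) z - A.map (algebraMap ℝ ℂ))
    (-(B.map (algebraMap ℝ ℂ))) (C.map (algebraMap ℝ ℂ)) 0

/-- `z` is an invariant zero: the system matrix drops below its normal (that is, maximal) rank. -/
def IsInvariantZero {n m p : ℕ} (C : Matrix (Fin p) (Fin n) ℝ) (A : Matrix (Fin n) (Fin n) ℝ)
    (B : Matrix (Fin n) (Fin m) ℝ) (z : ℂ) : Prop :=
  ∃ w : ℂ, (systemMatrix C A B z).rank < (systemMatrix C A B w).rank

/-- A square system is of uniform rank `nq` (all its infinite zeros have order `nq`):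
`C A ^ k B = 0` for `k < nq - 1` and `C A ^ (nq - 1) B` is nonsingular. -/
def UniformRank {n p : ℕ} (C : Matrix (Fin p) (Fin n) ℝ) (A : Matrix (Fin n) (Fin n) ℝ)
    (B : Matrix (Fin n) (Fin p) ℝ) (nq : ℕ) : Prop :=
  1 ≤ nq ∧ (∀ k, k + 1 < nq → C * A ^ k * B = 0) ∧ IsUnit (C * A ^ (nq - 1) * B)

/-! ### Agents and exosystem -/

/-- An introspective agent `x⁺ = A x + B u`, `y = C x`, with local measurement `z = Cm x`. -/
structure Agent (p : ℕ) where
  n : ℕ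
  m : ℕ
  q : ℕ
  A : Matrix (Fin n) (Fin n) ℝ
  B : Matrix (Fin n) (Fin m) ℝ
  C : Matrix (Fin p) (Fin n) ℝ
  Cm : Matrix (Fin q) (Fin n) ℝ

/-- The standing assumption on an agent. -/
structure Agent.Admissible {p : ℕ} (ag : Agent p) : Prop where
  stabilizable : Stabilizable ag.A ag.B
  detectable : Detectable ag.C ag.A
  rightInvertible : RightInvertible ag.C ag.A ag.B
  detectable_local : Detectable ag.Cm ag.A

/-- An exosystem `x⁺ = A x`, `y = C x`. -/
structure Exosystem (p : ℕ) where
  r : ℕ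
  A : Matrix (Fin r) (Fin r) ℝ
  C : Matrix (Fin p) (Fin r) ℝ

/-- The standing assumption on the exosystem. -/
structure Exosystem.Admissible {p : ℕ} (exo : Exosystem p) : Prop where
  observable : Observable exo.C exo.A
  unitCircle : EigenvaluesOnUnitCircle exo.A

/-! ### Communication network -/

/-- The Laplacian of the weighted directed graph with weights `a i j` (edge from `j` to `i`). -/
def laplacian {N : ℕ} (a : Matrix (Fin N) (Fin N) ℝ) : Matrix (Fin N) (Fin N) ℝ :=
  Matrix.of fun i j => if i = j then ∑ l, a i l else -a i j

/-- The set of graphs `𝔾^N`: the graph is a directed spanning tree, and its Laplacian is lower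
triangular. The node with index `0` is the root (it has no parent, by triangularity), every other
node has exactly one parent. -/
structure IsTreeGraph {N : ℕ} (a : Matrix (Fin N) (Fin N) ℝ) : Prop where
  nonneg : ∀ i j, 0 ≤ a i j
  no_loops : ∀ i, a i i = 0
  lowerTriangular : ∀ i j, i < j → laplacian a i j = 0
  parent : ∀ i : Fin N, i.val ≠ 0 → ∃! j, 0 < a i j

/-- A weighted graph together with the communication delays: `κ i j` and `κhat i j` are the delays
from agent `j` to agent `i` of the outputs and of the exchanged protocol variables, and `κroot` is
the delay from the exosystem to the root agent. -/
structure Network (N : ℕ) where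
  a : Matrix (Fin N) (Fin N) ℝ
  κ : Fin N → Fin N → ℕ
  κhat : Fin N → Fin N → ℕ
  κroot : ℕ

/-- In-degree `d_in(i)`. -/
def Network.inDegree {N : ℕ} (G : Network N) (i : Fin N) : ℝ := ∑ j, G.a i j

/-- `ι_i`: only the root agent has access to the exosystem. -/
def rootIndicator {N : ℕ} (i : Fin N) : ℝ := if i.val = 0 then 1 else 0

open Classical in
/-- The sum `κ_ir` of the delays along the path from the exosystem, through the root, to agent
`i`. In a tree graph the sum below has exactly one nonzero contribution, that of the parent of
`i`. -/
def Network.delayFromExo {N : ℕ} (G : Network N) (i : Fin N) : ℕ :=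
  if i.val = 0 then G.κroot
  else ∑ j : Fin N, if _h : j < i ∧ 0 < G.a i j then G.κ i j + G.delayFromExo j else 0
termination_by i.val
decreasing_by exact _h.1

/-- The relative output information `ζ̄_i(k)` that the network delivers to agent `i`. -/
def Network.zetaBar {N p : ℕ} (G : Network N) (y : Fin N → ℤ → Fin p → ℝ) (yr : ℤ → Fin p → ℝ)
    (i : Fin N) (k : ℤ) : Fin p → ℝ :=
  (2 + G.inDegree i)⁻¹ •
    (∑ j, G.a i j • (y i k - y j (k - G.κ i j))
      + rootIndicator i • (y i k - yr (k - G.κroot)))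

/-- The localized information exchange `ζ̂_i(k)` of the protocol variables `ξ_j`. -/
def Network.zetaHat {N d : ℕ} (G : Network N) (ξ : Fin N → ℤ → Fin d → ℝ)
    (i : Fin N) (k : ℤ) : Fin d → ℝ :=
  (2 + G.inDegree i)⁻¹ •
    (∑ j, G.a i j • (ξ i k - ξ j (k - G.κhat i j)) + rootIndicator i • ξ i k)

/-! ### Linear dynamic protocols and the synchronization problem -/

/-- A linear dynamic protocol
`x_c⁺ = A x_c + B ζ̄ + C ζ̂ + D z`, `u = E x_c + F ζ̄ + G ζ̂ + H z`
with state index set `σ`, which transmits `ξ = X x_c` over the network. -/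
structure Protocol (σ : Type) (p m q d : ℕ) where
  A : Matrix σ σ ℝ
  B : Matrix σ (Fin p) ℝ
  C : Matrix σ (Fin d) ℝ
  D : Matrix σ (Fin q) ℝ
  E : Matrix (Fin m) σ ℝ
  F : Matrix (Fin m) (Fin p) ℝ
  G : Matrix (Fin m) (Fin d) ℝ
  H : Matrix (Fin m) (Fin q) ℝ
  X : Matrix (Fin d) σ ℝ

/-- Closed-loop trajectories. The agents of the network are numbered by `Fin N`, agent `i` has the
model `ag (s i)` and runs the protocol `P (s i)`. The state equations hold for `k ≥ 0`; the values
at negative times are an arbitrary prehistory for the delayed signals. -/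
structure IsTrajectory {p d N : ℕ} {ι : Type} (exo : Exosystem p) (ag : ι → Agent p)
    (σ : ι → Type) [∀ t, Fintype (σ t)]
    (P : ∀ t, Protocol (σ t) p (ag t).m (ag t).q d)
    (s : Fin N → ι) (G : Network N)
    (xr : ℤ → Fin exo.r → ℝ) (x : ∀ i, ℤ → Fin (ag (s i)).n → ℝ) (u : ∀ i, ℤ → Fin (ag (s i)).m → ℝ)
    (xc : ∀ i, ℤ → σ (s i) → ℝ)
    (yr : ℤ → Fin p → ℝ) (y : Fin N → ℤ → Fin p → ℝ) (ξ : Fin N → ℤ → Fin d → ℝ) : Prop where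
  exoState : ∀ k : ℤ, 0 ≤ k → xr (k + 1) = exo.A *ᵥ xr k
  exoOutput : ∀ k : ℤ, 0 ≤ k → yr k = exo.C *ᵥ xr k
  state : ∀ i, ∀ k : ℤ, 0 ≤ k →
    x i (k + 1) = (ag (s i)).A *ᵥ x i k + (ag (s i)).B *ᵥ u i k
  output : ∀ i, ∀ k : ℤ, 0 ≤ k → y i k = (ag (s i)).C *ᵥ x i k
  protocolState : ∀ i, ∀ k : ℤ, 0 ≤ k →
    xc i (k + 1) = (P (s i)).A *ᵥ xc i k + (P (s i)).B *ᵥ G.zetaBar y yr i k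
      + (P (s i)).C *ᵥ G.zetaHat ξ i k + (P (s i)).D *ᵥ ((ag (s i)).Cm *ᵥ x i k)
  input : ∀ i, ∀ k : ℤ, 0 ≤ k →
    u i k = (P (s i)).E *ᵥ xc i k + (P (s i)).F *ᵥ G.zetaBar y yr i k
      + (P (s i)).G *ᵥ G.zetaHat ξ i k + (P (s i)).H *ᵥ ((ag (s i)).Cm *ᵥ x i k)
  transmitted : ∀ i, ∀ k : ℤ, 0 ≤ k → ξ i k = (P (s i)).X *ᵥ xc i k

/-- The protocols `P` (one for each agent model) solve the scalable delayed regulated output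
synchronization problem: for any number `N` of agents with models from the family, any tree graph,
any communication delays, and any initial data,
`y_i(k) - y_r(k - κ_ir) → 0` as `k → ∞`, for all `i`. -/
def SolvesDelayedOutputSync {p d : ℕ} {ι : Type} (exo : Exosystem p) (ag : ι → Agent p)
    (σ : ι → Type) [∀ t, Fintype (σ t)]
    (P : ∀ t, Protocol (σ t) p (ag t).m (ag t).q d) : Prop :=
  ∀ (N : ℕ) (s : Fin N → ι) (G : Network N), IsTreeGraph G.a →
    ∀ xr x u xc yr y ξ, IsTrajectory exo ag σ P s G xr x u xc yr y ξ →
      ∀ i : Fin N, Tendsto (fun k : ℤ => y i k - yr (k - G.delayFromExo i)) atTop (𝓝 0)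

/-- The scalable delayed regulated output synchronization problem is solvable. -/
def DelayedOutputSyncSolvable {p : ℕ} {ι : Type} (exo : Exosystem p) (ag : ι → Agent p) : Prop :=
  ∃ (d : ℕ) (nc : ι → ℕ)
    (P : ∀ t, Protocol (Fin (nc t)) p (ag t).m (ag t).q d),
    SolvesDelayedOutputSync exo ag (fun t => Fin (nc t)) P

/-! ### The protocol -/

/-- `nq` is at least the order of every infinite zero of every agent and every observability
index of the exosystem. -/
structure IsAdmissibleRank {p : ℕ} {ι : Type} (exo : Exosystem p) (ag : ι → Agent p)
    (nq : ℕ) : Prop where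
  pos : 1 ≤ nq
  infiniteZeros : ∀ t q, HasInfiniteZero (ag t).C (ag t).A (ag t).B q → q ≤ nq
  observabilityIndices : observabilityIndex exo.C exo.A ≤ nq

/-- A target model `x⁺ = A x + B (v + ρ)`, `y = C x` with as many inputs as outputs. -/
structure TargetModel (p : ℕ) where
  n : ℕ
  A : Matrix (Fin n) (Fin n) ℝ
  B : Matrix (Fin n) (Fin p) ℝ
  C : Matrix (Fin p) (Fin n) ℝ

/-- Remodeling of the exosystem: the target model generates all outputs of the exosystem, it is
invertible, of uniform rank `nq` and without invariant zeros, and its eigenvalues are those of the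
exosystem and additional zeros (counted with multiplicity). -/
structure TargetModel.Remodels {p : ℕ} (T : TargetModel p) (exo : Exosystem p) (nq : ℕ) :
    Prop where
  sameOutputs : ∀ x₀ : Fin exo.r → ℝ, ∃ w₀ : Fin T.n → ℝ, ∀ k : ℕ,
    (T.C * T.A ^ k) *ᵥ w₀ = (exo.C * exo.A ^ k) *ᵥ x₀
  rightInvertible : RightInvertible T.C T.A T.B
  leftInvertible : LeftInvertible T.C T.A T.B
  uniformRank : UniformRank T.C T.A T.B nq
  noInvariantZero : ∀ z, ¬ IsInvariantZero T.C T.A T.B z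
  eigenvalues : ∃ l : ℕ, T.A.charpoly = exo.A.charpoly * Polynomial.X ^ l

/-- A pre-compensator `ξ⁺ = Ah ξ + Bh z + Eh v`, `u = Ch ξ + Dh v` for an agent. -/
structure PreCompensator {p : ℕ} (ag : Agent p) where
  n : ℕ
  Ah : Matrix (Fin n) (Fin n) ℝ
  Bh : Matrix (Fin n) (Fin ag.q) ℝ
  Eh : Matrix (Fin n) (Fin p) ℝ
  Ch : Matrix (Fin ag.m) (Fin n) ℝ
  Dh : Matrix (Fin ag.m) (Fin p) ℝ

/-- The pre-compensator homogenizes the agent: for every input `v` and all initial states, the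
compensated agent has the output of the target model `x_h⁺ = A x_h + B (v + ρ)`, `y = C x_h`, where
`ρ` is generated by `ω⁺ = As ω`, `ρ = Cs ω` with `As` Schur stable. -/
def PreCompensator.Homogenizes {p : ℕ} {ag : Agent p} (c : PreCompensator ag)
    (T : TargetModel p) : Prop :=
  ∃ (ns : ℕ) (As : Matrix (Fin ns) (Fin ns) ℝ) (Cs : Matrix (Fin p) (Fin ns) ℝ), IsSchur As ∧
    ∀ (x : ℕ → Fin ag.n → ℝ) (ξ : ℕ → Fin c.n → ℝ) (v : ℕ → Fin p → ℝ),
      (∀ k, x (k + 1) = ag.A *ᵥ x k + ag.B *ᵥ (c.Ch *ᵥ ξ k + c.Dh *ᵥ v k)) →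
      (∀ k, ξ (k + 1) = c.Ah *ᵥ ξ k + c.Bh *ᵥ (ag.Cm *ᵥ x k) + c.Eh *ᵥ v k) →
      ∃ (xh : ℕ → Fin T.n → ℝ) (ω : ℕ → Fin ns → ℝ),
        (∀ k, xh (k + 1) = T.A *ᵥ xh k + T.B *ᵥ (v k + Cs *ᵥ ω k)) ∧
        (∀ k, ω (k + 1) = As *ᵥ ω k) ∧
        (∀ k, ag.C *ᵥ x k = T.C *ᵥ xh k)

/-- The final protocol, with state `(ξ, x̂, χ)` and transmitted variable `χ`:
`ξ⁺ = Ah ξ + Bh z - Eh K χ`,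
`x̂⁺ = A x̂ - B K ζ̂ + H (ζ̄ - C x̂)`,
`χ⁺ = (A - B K) χ + A x̂ - A ζ̂`,
`u = Ch ξ - Dh K χ`. -/
def finalProtocol {p : ℕ} {ag : Agent p} (T : TargetModel p) (c : PreCompensator ag)
    (K : Matrix (Fin p) (Fin T.n) ℝ) (H : Matrix (Fin T.n) (Fin p) ℝ) :
    Protocol (Fin c.n ⊕ (Fin T.n ⊕ Fin T.n)) p ag.m ag.q T.n where
  A := Matrix.fromBlocks c.Ah (Matrix.fromCols 0 (-(c.Eh * K)))
    0 (Matrix.fromBlocks (T.A - H * T.C) 0 T.A (T.A - T.B * K))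
  B := Matrix.fromRows 0 (Matrix.fromRows H 0)
  C := Matrix.fromRows 0 (Matrix.fromRows (-(T.B * K)) (-T.A))
  D := Matrix.fromRows c.Bh 0
  E := Matrix.fromCols c.Ch (Matrix.fromCols 0 (-(c.Dh * K)))
  F := 0
  G := 0
  H := 0
  X := Matrix.fromCols 0 (Matrix.fromCols 0 1)

end DelayedSync

end

open DelayedSync

/-!
The compensated agents all look like one target model `x⁺ = A x + B (v + ρ)`, `y = C x`, and the
network is a tree; so the synchronization errors can be shown to vanish agent by agent, and the
remaining work is to construct the target model and the pre-compensators.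

*Target model.* A square system of uniform rank `nq` without invariant zeros is observable in `nq`
steps (`UniformRank.observableIn`): its state is the window of the next `nq` outputs, which are
continued by a recursion `y (k + nq) = ∑ Φ_j y (k + j) + Γ v k`. This makes deadbeat choices of `K`
and `H` explicit (`UniformRank.exists_feedback`, `UniformRank.exists_injection`). Conversely, a
target model is given by a continuation rule on windows of length `nq`. It has to continue the
outputs of the exosystem correctly and to turn every window into such an output window after `nq`
steps, so that only zero eigenvalues are added; a feedback that descends a chain of subspaces does
this (`exists_continuation`, `exists_remodels`).

*Pre-compensators.* By the Smith form at infinity, a right-invertible system whose infinite zeros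
have orders at most `nq` has a right inverse with delay exactly `nq`, as a power series in `z⁻¹`
(`RightInvertible.exists_expansion_mul_of_le`). The pre-compensator keeps an observer and a plan of
the next `nq` inputs. Along the coefficients of the right inverse the plan can be revised so that
the outputs already promised stay the same and the one after them is what the target recursion
prescribes; the observer error only adds the vanishing disturbance `ρ` (`exists_homogenizes`). No
inversion of the zero dynamics is needed.

*Synchronization.* Let `x̄` be the deviation of the target state of an agent from the delayed target
state that generates the reference. With `c = a / (2 + a)`, `a` the weight of the edge from the
parent (`c = 1 / 2` at the root), the signals `c (x̄ - x̄ᵈ) - x̂` and `x̄ - χ` are states of systems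
with matrices `A - H C` and `(1 - c) A`, and `x̄` is the state of a system with matrix `A - B K`; all
their inputs vanish if the delayed signals `x̄ᵈ`, `χᵈ` of the parent do
(`tendsto_zero_of_error_dynamics`). That `(1 - c) A` is Schur stable is where the eigenvalues of the
exosystem, on the unit circle, enter.
-/

namespace DelayedSync

/-! ### Schur stability -/

section
attribute [local instance] Matrix.linftyOpNormedRing Matrix.linftyOpNormedAlgebra

/-- Gelfand's formula: some power of a complex matrix with spectrum in the open unit disc is a
contraction. -/
theorem exists_norm_pow_lt_one {n : ℕ} (M : Matrix (Fin n) (Fin n) ℂ)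
    (hM : ∀ z ∈ spectrum ℂ M, ‖z‖ < 1) : ∃ k, 0 < k ∧ ‖M ^ k‖ < 1 := by
  rcases isEmpty_or_nonempty (Fin n) with h | h
  · exact ⟨1, one_pos, by simp [Subsingleton.elim (M ^ 1) 0]⟩
  have hr : spectralRadius ℂ M < (1 : NNReal) :=
    spectrum.spectralRadius_lt_of_forall_lt M fun z hz => by
      exact_mod_cast hM z hz
  have := (spectrum.pow_nnnorm_pow_one_div_tendsto_nhds_spectralRadius M).eventually_lt_const hr
  obtain ⟨k, hk, hk1⟩ := (this.and (eventually_gt_atTop 0)).exists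
  refine ⟨k, hk1, ?_⟩
  by_contra! h1
  have h2 : (1 : ENNReal) ≤ (‖M ^ k‖₊ : ENNReal) := by exact_mod_cast h1
  have h3 := ENNReal.rpow_le_rpow h2 (z := 1 / (k : ℝ)) (by positivity)
  rw [ENNReal.one_rpow] at h3
  exact absurd hk (not_lt.2 (by simpa using h3))

end

/-- A nonnegative sequence with `a (k + 1) ≤ t a k + b k`, `t < 1` and `b → 0` tends to zero. -/
theorem tendsto_zero_of_le_mul_add {a b : ℕ → ℝ} {t : ℝ} (ht0 : 0 ≤ t) (ht1 : t < 1)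
    (ha : ∀ k, 0 ≤ a k) (h : ∀ k, a (k + 1) ≤ t * a k + b k) (hb : Tendsto b atTop (𝓝 0)) :
    Tendsto a atTop (𝓝 0) := by
  rw [Metric.tendsto_atTop]
  intro ε hε
  obtain ⟨N, hN⟩ := (Metric.tendsto_atTop.1 hb) ((1 - t) * (ε / 2))
    (mul_pos (by linarith) (by linarith))
  have key : ∀ j, a (N + j) ≤ ε / 2 + t ^ j * a N := by
    intro j
    induction j with
    | zero => simp; linarith
    | succ j ih =>
      have h1 := h (N + j)
      have h2 := hN (N + j) (by omega)
      rw [Real.dist_eq, sub_zero] at h2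
      have h3 := le_abs_self (b (N + j))
      have h4 := mul_le_mul_of_nonneg_left ih ht0
      rw [← add_assoc]
      calc a (N + j + 1) ≤ t * (ε / 2 + t ^ j * a N) + (1 - t) * (ε / 2) := by linarith
        _ = _ := by ring
  have ht : Tendsto (fun j => t ^ j * a N) atTop (𝓝 0) := by
    simpa using (tendsto_pow_atTop_nhds_zero_of_lt_one ht0 ht1).mul_const (a N)
  obtain ⟨J, hJ⟩ := (Metric.tendsto_atTop.1 ht) (ε / 2) (by linarith)
  refine ⟨N + J, fun k hk => ?_⟩
  obtain ⟨j, rfl⟩ := Nat.exists_eq_add_of_le (show N ≤ k by omega)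
  have h1 := key j
  have h2 := hJ j (by omega)
  rw [Real.dist_eq, sub_zero] at h2 ⊢
  rw [abs_of_nonneg (ha _)]
  have := le_abs_self (t ^ j * a N)
  linarith

section
attribute [local instance] Matrix.linftyOpNormedRing Matrix.linftyOpNormedAlgebra

/-- Complex form of `IsSchur.tendsto_zero`. The contraction is measured in the adapted gauge
`V x = ∑_{j < m} r ^ j ‖M ^ j x‖`, for which `V (M x) ≤ r⁻¹ V x` if `r ^ m ‖M ^ m‖ ≤ 1`. -/
theorem tendsto_zero_of_spectrum {n : ℕ} (M : Matrix (Fin n) (Fin n) ℂ)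
    (hM : ∀ z ∈ spectrum ℂ M, ‖z‖ < 1) {s w : ℕ → Fin n → ℂ}
    (hs : ∀ k, s (k + 1) = M *ᵥ s k + w k) (hw : Tendsto w atTop (𝓝 0)) :
    Tendsto s atTop (𝓝 0) := by
  obtain ⟨m, hm, hlt⟩ := exists_norm_pow_lt_one M hM
  -- a rate `r > 1` so close to `1` that `r ^ m ‖M ^ m‖ ≤ 1`
  obtain ⟨r, hr1, hr⟩ : ∃ r : ℝ, 1 < r ∧ r ^ m * ‖M ^ m‖ ≤ 1 := by
    have hc : Tendsto (fun r : ℝ => r ^ m * ‖M ^ m‖) (𝓝[>] 1) (𝓝 (1 ^ m * ‖M ^ m‖)) :=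
      ((continuous_id.pow m).mul_const _).continuousAt.tendsto.mono_left nhdsWithin_le_nhds
    have h1 := hc.eventually_lt_const (show 1 ^ m * ‖M ^ m‖ < 1 by simpa using hlt)
    obtain ⟨r, h2, h3⟩ := (h1.and self_mem_nhdsWithin).exists
    exact ⟨r, h3, h2.le⟩
  have hr0 : 0 < r := by linarith
  set V : (Fin n → ℂ) → ℝ := fun x => ∑ j ∈ Finset.range m, r ^ j * ‖M ^ j *ᵥ x‖ with hV
  have hVM : ∀ x, V (M *ᵥ x) ≤ r⁻¹ * V x := by
    intro x
    have e1 : r * V (M *ᵥ x) = ∑ j ∈ Finset.range m, r ^ (j + 1) * ‖M ^ (j + 1) *ᵥ x‖ := by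
      rw [hV, Finset.mul_sum]
      refine Finset.sum_congr rfl fun j _ => ?_
      rw [Matrix.mulVec_mulVec, ← pow_succ, pow_succ r]; ring
    have e2 := Finset.sum_range_succ' (fun j => r ^ j * ‖M ^ j *ᵥ x‖) m
    have e3 := Finset.sum_range_succ (fun j => r ^ j * ‖M ^ j *ᵥ x‖) m
    have e4 : r ^ m * ‖M ^ m *ᵥ x‖ ≤ ‖x‖ := by
      calc r ^ m * ‖M ^ m *ᵥ x‖ ≤ r ^ m * (‖M ^ m‖ * ‖x‖) := by
            gcongr; exact Matrix.linfty_opNorm_mulVec _ _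
        _ = (r ^ m * ‖M ^ m‖) * ‖x‖ := by ring
        _ ≤ 1 * ‖x‖ := by gcongr
        _ = ‖x‖ := one_mul _
    have e5 : r * V (M *ᵥ x) ≤ V x := by
      rw [e1]
      have : V x = ∑ j ∈ Finset.range m, r ^ j * ‖M ^ j *ᵥ x‖ := rfl
      simp only [pow_zero, Matrix.one_mulVec, one_mul] at e2
      linarith
    rw [inv_mul_eq_div, le_div_iff₀ hr0]; linarith
  have hVadd : ∀ x y, V (x + y) ≤ V x + V y := by
    intro x y
    rw [hV, ← Finset.sum_add_distrib]
    refine Finset.sum_le_sum fun j _ => ?_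
    rw [← mul_add, Matrix.mulVec_add]
    gcongr
    exact norm_add_le _ _
  have hVcont : Continuous V := by
    refine continuous_finsetSum _ fun j _ => continuous_const.mul ?_
    exact (Continuous.matrix_mulVec continuous_const continuous_id).norm
  have hVw : Tendsto (fun k => V (w k)) atTop (𝓝 0) := by
    have := (hVcont.tendsto 0).comp hw
    simpa [hV, Function.comp_def] using this
  have hVle : ∀ x, ‖x‖ ≤ V x := by
    intro x
    have : r ^ 0 * ‖M ^ 0 *ᵥ x‖ ≤ V x :=
      Finset.single_le_sum (f := fun j => r ^ j * ‖M ^ j *ᵥ x‖) (fun j _ => by positivity)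
        (Finset.mem_range.2 hm)
    simpa using this
  have hlim := tendsto_zero_of_le_mul_add (a := fun k => V (s k)) (inv_nonneg.2 hr0.le)
    (inv_lt_one_of_one_lt₀ hr1) (fun k => (norm_nonneg _).trans (hVle _))
    (fun k => by
      rw [hs]; exact (hVadd _ _).trans (by gcongr; exact hVM _)) hVw
  exact squeeze_zero_norm (fun k => hVle (s k)) hlim

end

/-- A Schur stable system driven by a vanishing input has a vanishing state. -/
theorem IsSchur.tendsto_zero {n : ℕ} {M : Matrix (Fin n) (Fin n) ℝ} (hM : IsSchur M)
    {s w : ℕ → Fin n → ℝ} (hs : ∀ k, s (k + 1) = M *ᵥ s k + w k)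
    (hw : Tendsto w atTop (𝓝 0)) : Tendsto s atTop (𝓝 0) := by
  have key := tendsto_zero_of_spectrum (M.map (algebraMap ℝ ℂ)) hM
    (s := fun k i => (s k i : ℂ)) (w := fun k i => (w k i : ℂ)) (fun k => by
      ext i
      rw [hs]
      simp [Matrix.mulVec, dotProduct])
    (by
      rw [tendsto_pi_nhds] at hw ⊢
      intro i
      simpa [Function.comp_def] using (Complex.continuous_ofReal.tendsto 0).comp (hw i))
  rw [tendsto_pi_nhds] at key ⊢
  intro i
  simpa [Function.comp_def] using (Complex.continuous_re.tendsto 0).comp (key i)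

theorem isSchur_of_pow_eq_zero {n k : ℕ} {M : Matrix (Fin n) (Fin n) ℝ} (h : M ^ k = 0) :
    IsSchur M := by
  intro z hz
  have hk : (M.map (algebraMap ℝ ℂ)) ^ k = 0 := by
    rw [← Matrix.map_pow, h, Matrix.map_zero _ (map_zero _)]
  have h1 := spectrum.pow_mem_pow (M.map (algebraMap ℝ ℂ)) k hz
  rw [hk] at h1
  rcases subsingleton_or_nontrivial (Matrix (Fin n) (Fin n) ℂ) with hs | hs
  · rw [spectrum.of_subsingleton] at h1; exact h1.elim
  · rw [spectrum.zero_eq, Set.mem_singleton_iff] at h1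
    rw [eq_zero_of_pow_eq_zero h1]
    simp

/-! ### Square systems of uniform rank without invariant zeros -/

section Zeros

variable {n p nq : ℕ} {A : Matrix (Fin n) (Fin n) ℝ} {B : Matrix (Fin n) (Fin p) ℝ}
  {C : Matrix (Fin p) (Fin n) ℝ}

theorem systemMatrix_mulVec_eq_zero {m : ℕ} {B : Matrix (Fin n) (Fin m) ℝ} {z : ℂ}
    {x : Fin n → ℂ} {u : Fin m → ℂ} :
    systemMatrix C A B z *ᵥ Sum.elim x u = 0 ↔
      z • x = A.map (algebraMap ℝ ℂ) *ᵥ x + B.map (algebraMap ℝ ℂ) *ᵥ u ∧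
        C.map (algebraMap ℝ ℂ) *ᵥ x = 0 := by
  rw [systemMatrix, Matrix.fromBlocks_mulVec, ← Sum.elim_zero_zero, Sum.elim_eq_iff]
  simp only [Sum.elim_comp_inl, Sum.elim_comp_inr, Matrix.sub_mulVec, Matrix.neg_mulVec,
    Matrix.zero_mulVec, add_zero, Matrix.scalar_apply, ← Matrix.smul_one_eq_diagonal,
    Matrix.smul_mulVec, Matrix.one_mulVec]
  rw [← sub_eq_add_neg, sub_sub, sub_eq_zero]

theorem rank_systemMatrix_lt {m : ℕ} {B : Matrix (Fin n) (Fin m) ℝ} {z w : ℂ}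
    {v : Fin n ⊕ Fin m → ℂ} (hv : v ≠ 0) (hz : systemMatrix C A B z *ᵥ v = 0)
    (hw : ∀ v, systemMatrix C A B w *ᵥ v = 0 → v = 0) :
    (systemMatrix C A B z).rank < (systemMatrix C A B w).rank := by
  have e1 := (systemMatrix C A B z).mulVecLin.finrank_range_add_finrank_ker
  have e2 := (systemMatrix C A B w).mulVecLin.finrank_range_add_finrank_ker
  have k2 : LinearMap.ker (systemMatrix C A B w).mulVecLin = ⊥ :=
    LinearMap.ker_eq_bot'.2 fun v h => hw v h
  have k1 : 0 < Module.finrank ℂ (LinearMap.ker (systemMatrix C A B z).mulVecLin) := by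
    rw [Module.finrank_pos_iff_exists_ne_zero]
    exact ⟨⟨v, hz⟩, fun h => hv (congrArg Subtype.val h)⟩
  rw [k2, finrank_bot] at e2
  rw [Matrix.rank, Matrix.rank]
  omega

/-- The complexification of a block `C A ^ k B`. -/
theorem map_mul_pow_mul {m : ℕ} (B : Matrix (Fin n) (Fin m) ℝ) (k : ℕ) :
    C.map (algebraMap ℝ ℂ) * A.map (algebraMap ℝ ℂ) ^ k * B.map (algebraMap ℝ ℂ) =
      (C * A ^ k * B).map (algebraMap ℝ ℂ) := by
  rw [← Matrix.map_pow, ← Matrix.map_mul, ← Matrix.map_mul]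

/-- The kernel of the system matrix of a system of uniform rank lies in the kernel of the
observability matrix. -/
theorem UniformRank.kernel_systemMatrix (h : UniformRank C A B nq) {z : ℂ} {x : Fin n → ℂ}
    {u : Fin p → ℂ}
    (h1 : z • x = A.map (algebraMap ℝ ℂ) *ᵥ x + B.map (algebraMap ℝ ℂ) *ᵥ u)
    (h2 : C.map (algebraMap ℝ ℂ) *ᵥ x = 0) :
    (∀ j < nq, (C.map (algebraMap ℝ ℂ) * A.map (algebraMap ℝ ℂ) ^ j) *ᵥ x = 0) ∧
      (C.map (algebraMap ℝ ℂ) * A.map (algebraMap ℝ ℂ) ^ nq) *ᵥ x +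
        (C * A ^ (nq - 1) * B).map (algebraMap ℝ ℂ) *ᵥ u = 0 := by
  obtain ⟨hnq, h0, -⟩ := h
  rw [← map_mul_pow_mul]
  have g0 : ∀ k, k + 1 < nq → C.map (algebraMap ℝ ℂ) * A.map (algebraMap ℝ ℂ) ^ k *
      B.map (algebraMap ℝ ℂ) = 0 := fun k hk => by
    rw [map_mul_pow_mul, h0 k hk, Matrix.map_zero _ (map_zero _)]
  set a := A.map (algebraMap ℝ ℂ)
  set b := B.map (algebraMap ℝ ℂ)
  set c := C.map (algebraMap ℝ ℂ)
  have hca : ∀ j, c * a ^ (j + 1) = c * a ^ j * a := fun j => by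
    rw [pow_succ, Matrix.mul_assoc]
  have h3 : ∀ j < nq, (c * a ^ j) *ᵥ x = 0 := by
    intro j
    induction j with
    | zero => intro _; simpa using h2
    | succ j ih =>
      intro hj
      have h4 := congrArg ((c * a ^ j) *ᵥ ·) h1
      simp only [Matrix.mulVec_smul, Matrix.mulVec_add, Matrix.mulVec_mulVec,
        ih (by omega), g0 j hj, Matrix.zero_mulVec, smul_zero, add_zero, ← hca] at h4
      exact h4.symm
  have h4 := congrArg ((c * a ^ (nq - 1)) *ᵥ ·) h1
  simp only [Matrix.mulVec_smul, Matrix.mulVec_add, Matrix.mulVec_mulVec,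
    h3 (nq - 1) (by omega), smul_zero, ← hca, Nat.sub_add_cancel hnq] at h4
  exact ⟨h3, h4.symm⟩

/-- A system of uniform rank `nq` without invariant zeros is observable in `nq` steps: the
common kernel of the `C A ^ j`, `j < nq`, is invariant under `A - B Γ⁻¹ C A ^ nq`,
`Γ = C A ^ (nq - 1) B`, and an eigenvector of this matrix in that kernel would exhibit its
eigenvalue as an invariant zero. -/
theorem UniformRank.observableIn (h : UniformRank C A B nq)
    (hz : ∀ z, ¬ IsInvariantZero C A B z) : ObservableIn C A nq := by
  have hkersys := @UniformRank.kernel_systemMatrix _ _ _ _ _ _ h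
  obtain ⟨hnq, h0, hΓ⟩ := h
  rw [isUnit_iff_exists] at hΓ
  obtain ⟨Γi', hΓ1, hΓ2⟩ := hΓ
  have hmap := map_mul_pow_mul (A := A) (C := C) B
  set a := A.map (algebraMap ℝ ℂ) with ha
  set b := B.map (algebraMap ℝ ℂ) with hb
  set c := C.map (algebraMap ℝ ℂ) with hc
  have g0 : ∀ k, k + 1 < nq → c * a ^ k * b = 0 := fun k hk => by
    rw [hmap, h0 k hk, Matrix.map_zero _ (map_zero _)]
  set Γi : Matrix (Fin p) (Fin p) ℂ := Γi'.map (algebraMap ℝ ℂ)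
  have hGi1 : Γi * (c * a ^ (nq - 1) * b) = 1 := by
    rw [hmap, ← Matrix.map_mul, hΓ2, Matrix.map_one _ (map_zero _) (map_one _)]
  have hGi2 : (c * a ^ (nq - 1) * b) * Γi = 1 := by
    rw [hmap, ← Matrix.map_mul, hΓ1, Matrix.map_one _ (map_zero _) (map_one _)]
  set f := a - b * (Γi * (c * a ^ nq)) with hf
  have hca : ∀ j, c * a ^ (j + 1) = c * a ^ j * a := fun j => by
    rw [pow_succ, Matrix.mul_assoc]
  -- the kernel of the observability matrix is invariant under the feedback
  have hinv : ∀ j < nq, ∀ x, (∀ l < nq, (c * a ^ l) *ᵥ x = 0) → (c * a ^ j) *ᵥ (f *ᵥ x) = 0 := by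
    intro j hj x hx
    rw [Matrix.mulVec_mulVec, hf, Matrix.mul_sub, ← hca, ← Matrix.mul_assoc (c * a ^ j)]
    rcases (Nat.lt_or_ge (j + 1) nq) with h1 | h1
    · rw [g0 j h1, Matrix.zero_mul, sub_zero, hx _ h1]
    · have : j = nq - 1 := by omega
      subst this
      rw [← Matrix.mul_assoc, hGi2, Matrix.one_mul, Nat.sub_add_cancel hnq, sub_self,
        Matrix.zero_mulVec]
  have hker : ∀ (z : ℂ) (x : Fin n → ℂ) (u : Fin p → ℂ), z • x = a *ᵥ x + b *ᵥ u → c *ᵥ x = 0 →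
      z • x = f *ᵥ x ∧ u = -((Γi * (c * a ^ nq)) *ᵥ x) := by
    intro z x u h1 h2
    have h4 := (hkersys h1 h2).2
    rw [← hmap] at h4
    have h5 := congrArg (Γi *ᵥ ·) h4
    simp only [Matrix.mulVec_add, Matrix.mulVec_mulVec, hGi1, Matrix.one_mulVec,
      Matrix.mulVec_zero] at h5
    have hu : u = -((Γi * (c * a ^ nq)) *ᵥ x) := by
      rw [eq_neg_iff_add_eq_zero, add_comm]; exact h5
    refine ⟨?_, hu⟩
    rw [h1, hu, hf, Matrix.sub_mulVec, Matrix.mulVec_neg, Matrix.mulVec_mulVec, sub_eq_add_neg]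
  -- away from the spectrum of the feedback, the system matrix is injective
  obtain ⟨w, hw⟩ : ∃ w : ℂ, ¬ Module.End.HasEigenvalue (Matrix.toLin' f) w :=
    (Set.Finite.exists_notMem (Module.End.finite_hasEigenvalue (Matrix.toLin' f)))
  have hwker : ∀ v, systemMatrix C A B w *ᵥ v = 0 → v = 0 := by
    intro v hv
    rw [← Sum.elim_comp_inl_inr v, systemMatrix_mulVec_eq_zero] at hv
    obtain ⟨h1, h2⟩ := hker _ _ _ hv.1 hv.2
    have hx : v ∘ Sum.inl = 0 := by
      by_contra hne
      exact hw (Module.End.hasEigenvalue_of_hasEigenvector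
        ⟨Module.End.mem_eigenspace_iff.2 (by rw [Matrix.toLin'_apply, h1]), hne⟩)
    rw [hx, Matrix.mulVec_zero, neg_zero] at h2
    rw [← Sum.elim_comp_inl_inr v, hx, h2, Sum.elim_zero_zero]
  let V : Submodule ℂ (Fin n → ℂ) :=
    { carrier := {x | ∀ l < nq, (c * a ^ l) *ᵥ x = 0}
      add_mem' := fun {x y} hx hy l hl => by rw [Matrix.mulVec_add, hx l hl, hy l hl, add_zero]
      zero_mem' := fun l _ => Matrix.mulVec_zero _
      smul_mem' := fun r x hx l hl => by rw [Matrix.mulVec_smul, hx l hl, smul_zero] }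
  have hV : V = ⊥ := by
    by_contra hne
    have : Nontrivial V := Submodule.nontrivial_iff_ne_bot.2 hne
    obtain ⟨z, hzz⟩ := Module.End.exists_eigenvalue
      ((Matrix.toLin' f).restrict (p := V) (q := V) fun x hx l hl => by
        rw [Matrix.toLin'_apply]; exact hinv l hl x hx)
    obtain ⟨x, hx⟩ := hzz.exists_hasEigenvector
    have hx1 : f *ᵥ x.1 = z • x.1 := by
      have := congrArg Subtype.val hx.apply_eq_smul
      simpa using this
    refine hz z ⟨w, rank_systemMatrix_lt
      (v := Sum.elim x.1 (-((Γi * (c * a ^ nq)) *ᵥ x.1))) ?_ ?_ hwker⟩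
    · intro h0
      rw [← Sum.elim_zero_zero, Sum.elim_eq_iff] at h0
      exact hx.2 (Subtype.ext h0.1)
    · rw [systemMatrix_mulVec_eq_zero]
      refine ⟨?_, by have := x.2 0 hnq; rwa [pow_zero, Matrix.mul_one] at this⟩
      rw [← hx1, hf, Matrix.sub_mulVec, Matrix.mulVec_neg, Matrix.mulVec_mulVec, sub_eq_add_neg]
  intro x hx
  have hxV : (fun i => (x i : ℂ)) ∈ V := by
    intro l hl
    have h1 := hx l hl
    rw [ha, hc, ← Matrix.map_pow, ← Matrix.map_mul]
    ext i
    have h2 := congrFun h1 i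
    simp only [Matrix.mulVec, dotProduct, Pi.zero_apply, Matrix.map_apply, Complex.coe_algebraMap] at h2 ⊢
    exact_mod_cast h2
  rw [hV, Submodule.mem_bot] at hxV
  ext i
  simpa using congrFun hxV i

end Zeros

section Steering

variable {n p nq : ℕ} {A : Matrix (Fin n) (Fin n) ℝ} {B : Matrix (Fin n) (Fin p) ℝ}
  {C : Matrix (Fin p) (Fin n) ℝ}

/-- In a system of uniform rank `nq`, the states `∑_{i < nq} A ^ i B u_i` realize all values of
`C x, …, C A ^ (nq - 1) x`. -/
theorem UniformRank.exists_mem_span (h : UniformRank C A B nq) (S : Submodule ℝ (Fin n → ℝ))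
    (hS : ∀ i < nq, ∀ u, (A ^ i * B) *ᵥ u ∈ S) (y : ℕ → Fin p → ℝ) :
    ∃ x ∈ S, ∀ j < nq, (C * A ^ j) *ᵥ x = y j := by
  obtain ⟨hnq, h0, hΓ⟩ := h
  have key : ∀ t ≤ nq, ∃ x ∈ S, ∀ j < t, (C * A ^ j) *ᵥ x = y j := by
    intro t
    induction t with
    | zero => intro _; exact ⟨0, S.zero_mem, fun j hj => absurd hj (by omega)⟩
    | succ t ih =>
      intro ht
      obtain ⟨x, hxS, hx⟩ := ih (by omega)
      obtain ⟨Γ, hΓ1⟩ := hΓ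
      have hmul : ∀ j, C * A ^ j * (A ^ (nq - 1 - t) * B) = C * A ^ (j + (nq - 1 - t)) * B := by
        intro j; rw [pow_add]; simp only [Matrix.mul_assoc]
      refine ⟨x + (A ^ (nq - 1 - t) * B) *ᵥ
        ((Γ⁻¹ : (Matrix (Fin p) (Fin p) ℝ)ˣ).1 *ᵥ (y t - (C * A ^ t) *ᵥ x)),
        S.add_mem hxS (hS _ (by omega) _), fun j hj => ?_⟩
      rw [Matrix.mulVec_add, Matrix.mulVec_mulVec, hmul]
      rcases Nat.lt_succ_iff_lt_or_eq.1 hj with h1 | rfl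
      · rw [h0 _ (by omega), Matrix.zero_mulVec, add_zero, hx j h1]
      · rw [show j + (nq - 1 - j) = nq - 1 by omega, ← hΓ1, Matrix.mulVec_mulVec, Γ.mul_inv,
          Matrix.one_mulVec, add_sub_cancel]
  exact key nq le_rfl

/-- Deadbeat state feedback: with `K = Γ⁻¹ C A ^ nq` one has `C (A - B K) ^ j = C A ^ j` for
`j < nq` and `C (A - B K) ^ nq = 0`. -/
theorem UniformRank.exists_feedback (h : UniformRank C A B nq) (hO : ObservableIn C A nq) :
    ∃ K : Matrix (Fin p) (Fin n) ℝ, IsSchur (A - B * K) := by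
  obtain ⟨hnq, h0, ⟨Γ, hΓ1⟩⟩ := h
  set Γi : Matrix (Fin p) (Fin p) ℝ := ↑Γ⁻¹ with hΓi
  have hGi : (C * A ^ (nq - 1) * B) * Γi = 1 := by rw [hΓi, ← hΓ1]; exact Γ.mul_inv
  refine ⟨Γi * (C * A ^ nq), isSchur_of_pow_eq_zero (k := nq) ?_⟩
  set F := A - B * (Γi * (C * A ^ nq)) with hF
  have h1 : ∀ j < nq, C * F ^ j = C * A ^ j := by
    intro j
    induction j with
    | zero => intro _; simp
    | succ j ih =>
      intro hj
      rw [pow_succ, ← Matrix.mul_assoc, ih (by omega), hF, Matrix.mul_sub, ← Matrix.mul_assoc _ B,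
        h0 j hj, Matrix.zero_mul, sub_zero, pow_succ, Matrix.mul_assoc]
  have h2 : C * F ^ nq = 0 := by
    obtain ⟨m, rfl⟩ : ∃ m, nq = m + 1 := ⟨nq - 1, by omega⟩
    simp only [Nat.add_sub_cancel] at hGi
    rw [pow_succ F, ← Matrix.mul_assoc, h1 m (by omega), hF, Matrix.mul_sub,
      ← Matrix.mul_assoc _ B, ← Matrix.mul_assoc _ Γi, hGi, Matrix.one_mul, pow_succ,
      Matrix.mul_assoc, sub_self]
  refine Matrix.ext_of_mulVec_single fun i => ?_
  rw [Matrix.zero_mulVec]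
  refine hO _ fun l hl => ?_
  rw [← h1 l hl, Matrix.mulVec_mulVec, Matrix.mul_assoc, (Commute.pow_pow_self F l nq).eq,
    ← Matrix.mul_assoc, h2, Matrix.zero_mul, Matrix.zero_mulVec]

/-- Deadbeat output injection: with `H = A ^ nq B Γ⁻¹` one has `(A - H C) ^ j B = A ^ j B` for
`j < nq` and `(A - H C) ^ nq B = 0`. -/
theorem UniformRank.exists_injection (h : UniformRank C A B nq) (hO : ObservableIn C A nq) :
    ∃ H : Matrix (Fin n) (Fin p) ℝ, IsSchur (A - H * C) := by
  have hS := h.exists_mem_span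
  obtain ⟨hnq, h0, ⟨Γ, hΓ1⟩⟩ := h
  set Γi : Matrix (Fin p) (Fin p) ℝ := ↑Γ⁻¹ with hΓi
  have hGi : Γi * (C * A ^ (nq - 1) * B) = 1 := by rw [hΓi, ← hΓ1]; exact Γ.inv_mul
  refine ⟨A ^ nq * B * Γi, isSchur_of_pow_eq_zero (k := nq) ?_⟩
  set F := A - A ^ nq * B * Γi * C with hF
  have h1 : ∀ j < nq, F ^ j * B = A ^ j * B := by
    intro j
    induction j with
    | zero => intro _; simp
    | succ j ih =>
      intro hj
      rw [pow_succ', Matrix.mul_assoc, ih (by omega), hF, Matrix.sub_mul, Matrix.mul_assoc _ C,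
        ← Matrix.mul_assoc C, h0 j hj, Matrix.mul_zero, sub_zero, pow_succ', Matrix.mul_assoc]
  have h2 : F ^ nq * B = 0 := by
    obtain ⟨m, rfl⟩ : ∃ m, nq = m + 1 := ⟨nq - 1, by omega⟩
    simp only [Nat.add_sub_cancel] at hGi
    rw [pow_succ' F, Matrix.mul_assoc, h1 m (by omega), hF, Matrix.sub_mul, Matrix.mul_assoc _ C,
      ← Matrix.mul_assoc C, Matrix.mul_assoc _ Γi, hGi, Matrix.mul_one, pow_succ' A,
      Matrix.mul_assoc, sub_self]
  refine Matrix.ext_of_mulVec_single fun i => ?_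
  obtain ⟨x, hx, hxi⟩ := hS (LinearMap.ker (F ^ nq).mulVecLin) (fun i hi u => by
    rw [LinearMap.mem_ker, Matrix.mulVecLin_apply, Matrix.mulVec_mulVec, ← h1 i hi,
      ← Matrix.mul_assoc, (Commute.pow_pow_self F nq i).eq, Matrix.mul_assoc, h2,
      Matrix.mul_zero, Matrix.zero_mulVec]) (fun j => (C * A ^ j) *ᵥ Pi.single i 1)
  have : Pi.single i 1 = x := by
    rw [← sub_eq_zero]
    exact hO _ fun l hl => by rw [Matrix.mulVec_sub, hxi l hl, sub_self]
  rw [this, Matrix.zero_mulVec]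
  exact hx

/-- The output recursion of an observable pair: `C A ^ nq = ∑_{j < nq} Φ_j C A ^ j`. -/
theorem ObservableIn.exists_recursion (hO : ObservableIn C A nq) :
    ∃ Φ : Fin nq → Matrix (Fin p) (Fin p) ℝ, C * A ^ nq = ∑ j : Fin nq, Φ j * (C * A ^ j.val) := by
  let O : (Fin n → ℝ) →ₗ[ℝ] (Fin nq → Fin p → ℝ) :=
    LinearMap.pi fun j => (C * A ^ j.val).mulVecLin
  have hker : LinearMap.ker O = ⊥ := LinearMap.ker_eq_bot'.2 fun x hx =>
    hO x fun l hl => congrFun hx ⟨l, hl⟩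
  obtain ⟨L, hL⟩ := LinearMap.exists_leftInverse_of_injective O hker
  refine ⟨fun j => LinearMap.toMatrix' ((C * A ^ nq).mulVecLin ∘ₗ L ∘ₗ
    LinearMap.single ℝ (fun _ : Fin nq => Fin p → ℝ) j), ?_⟩
  refine Matrix.ext_of_mulVec_single fun i => ?_
  rw [Matrix.sum_mulVec]
  simp only [← Matrix.mulVec_mulVec, LinearMap.toMatrix'_mulVec, LinearMap.comp_apply]
  have h1 : ∑ j : Fin nq, LinearMap.single ℝ (fun _ : Fin nq => Fin p → ℝ) j
      (C *ᵥ A ^ j.val *ᵥ Pi.single i 1) = O (Pi.single i 1) := by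
    ext j : 1
    simp [O, Finset.sum_apply, Pi.single_apply]
  rw [← map_sum, ← map_sum, h1, ← LinearMap.comp_apply L, hL]
  simp

end Steering

/-! ### The structure at infinity of a right-invertible system -/

section Infinity

open PowerSeries in
/-- The expansion of the resolvent at infinity: `(1 - w A) ∑ A ^ k w ^ k = 1`. -/
theorem one_sub_smul_mul_geometric {n : ℕ} (A : Matrix (Fin n) (Fin n) ℝ) :
    (1 - (X : PowerSeries ℝ) • A.map (C (R := ℝ))) *
      (Matrix.of fun i j => PowerSeries.mk fun k => (A ^ k) i j) = 1 := by
  ext i j k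
  rw [Matrix.sub_mul, Matrix.one_mul, Matrix.smul_mul, Matrix.sub_apply, Matrix.smul_apply,
    Matrix.mul_apply, map_sub, Matrix.of_apply, coeff_mk, smul_eq_mul]
  cases k with
  | zero => by_cases h : i = j <;> simp [h, Matrix.one_apply]
  | succ k =>
    rw [coeff_succ_X_mul, map_sum, pow_succ', Matrix.mul_apply, sub_eq_zero.2]
    · by_cases h : i = j <;> simp [h, Matrix.one_apply, coeff_one]
    · refine Finset.sum_congr rfl fun l _ => ?_
      simp

open PowerSeries in
theorem expansionAtInfinity_eq {n m p : ℕ} (C : Matrix (Fin p) (Fin n) ℝ)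
    (A : Matrix (Fin n) (Fin n) ℝ) (B : Matrix (Fin n) (Fin m) ℝ) :
    expansionAtInfinity C A B = C.map (PowerSeries.C (R := ℝ)) *
      ((X : PowerSeries ℝ) • Matrix.of fun i j => PowerSeries.mk fun k => (A ^ k) i j) *
      B.map (PowerSeries.C (R := ℝ)) := by
  rw [Matrix.mul_smul, Matrix.smul_mul]
  ext i j : 1
  rw [expansionAtInfinity, Matrix.of_apply, Matrix.smul_apply, smul_eq_mul]
  refine congrArg ((X : PowerSeries ℝ) * ·) (PowerSeries.ext fun k => ?_)
  simp only [coeff_mk, Matrix.mul_apply, map_sum, Matrix.map_apply, Matrix.of_apply,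
    coeff_mul_C, coeff_C_mul]

/-- The embedding of the rational functions of `z` into the fractions of power series in `w = z⁻¹`. -/
theorem exists_ratFunc_hom (L : Type*) [Field L] [Algebra (PowerSeries ℝ) L]
    [IsFractionRing (PowerSeries ℝ) L] : ∃ φ : RatFunc ℝ →+* L,
    φ RatFunc.X = (algebraMap (PowerSeries ℝ) (L) PowerSeries.X)⁻¹ ∧
    ∀ r, φ (algebraMap ℝ (RatFunc ℝ) r) =
      algebraMap (PowerSeries ℝ) (L) (PowerSeries.C r) := by
  set w : L := algebraMap (PowerSeries ℝ) (L) PowerSeries.X with hw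
  have hinj : Function.Injective (algebraMap (PowerSeries ℝ) (L)) :=
    IsFractionRing.injective _ _
  have hw0 : w ≠ 0 := by
    rw [hw, Ne, map_eq_zero_iff _ hinj]; exact PowerSeries.X_ne_zero
  let i : ℝ →+* L :=
    (algebraMap (PowerSeries ℝ) (L)).comp (PowerSeries.C (R := ℝ))
  let ψ : Polynomial ℝ →+* L := Polynomial.eval₂RingHom i w⁻¹
  have hψ : ∀ f, ψ f = 0 → f = 0 := by
    intro f hf
    -- the reversed polynomial, as a power series in `w`, vanishes
    let _ : Invertible w⁻¹ := ⟨w, mul_inv_cancel₀ hw0, inv_mul_cancel₀ hw0⟩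
    have h1 : Polynomial.eval₂ i w f.reverse * w⁻¹ ^ f.natDegree = 0 := by
      rw [← hf]; exact Polynomial.eval₂_reverse_mul_pow i w⁻¹ f
    have h2 : Polynomial.eval₂ i w f.reverse = 0 :=
      (mul_eq_zero.1 h1).resolve_right (pow_ne_zero _ (inv_ne_zero hw0))
    have h3 : Polynomial.eval₂ i w f.reverse =
        algebraMap (PowerSeries ℝ) (L) (f.reverse : PowerSeries ℝ) := by
      rw [← Polynomial.eval₂_C_X_eq_coe, Polynomial.hom_eval₂]
    rw [h3, map_eq_zero_iff _ hinj] at h2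
    have h4 : f.reverse = 0 := by exact_mod_cast h2
    exact Polynomial.reverse_eq_zero.1 h4
  have hle : nonZeroDivisors (Polynomial ℝ) ≤
      (nonZeroDivisors (L)).comap ψ := by
    intro f hf
    rw [Submonoid.mem_comap, mem_nonZeroDivisors_iff_ne_zero]
    exact fun h => nonZeroDivisors.ne_zero hf (hψ f h)
  refine ⟨RatFunc.liftRingHom ψ hle, ?_, fun r => ?_⟩
  · rw [← RatFunc.algebraMap_X, RatFunc.liftRingHom_algebraMap]
    simp [ψ]
  · rw [RatFunc.algebraMap_eq_C, ← RatFunc.algebraMap_C, RatFunc.liftRingHom_algebraMap]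
    simp [ψ, i]

theorem map_transferMatrix {L : Type*} [Field L] [Algebra (PowerSeries ℝ) L]
    [IsFractionRing (PowerSeries ℝ) L] {n m p : ℕ} (C : Matrix (Fin p) (Fin n) ℝ)
    (A : Matrix (Fin n) (Fin n) ℝ) (B : Matrix (Fin n) (Fin m) ℝ)
    (φ : RatFunc ℝ →+* L)
    (hX : φ RatFunc.X = (algebraMap (PowerSeries ℝ) (L) PowerSeries.X)⁻¹)
    (hC : ∀ r, φ (algebraMap ℝ (RatFunc ℝ) r) =
      algebraMap (PowerSeries ℝ) (L) (PowerSeries.C r)) :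
    (transferMatrix C A B).map φ =
      (expansionAtInfinity C A B).map (algebraMap (PowerSeries ℝ) (L)) := by
  set α := algebraMap (PowerSeries ℝ) (L) with hα
  set w := α PowerSeries.X with hw
  have hinj : Function.Injective α := IsFractionRing.injective _ _
  have hw0 : w ≠ 0 := by
    rw [hw, Ne, map_eq_zero_iff _ hinj]; exact PowerSeries.X_ne_zero
  have hcomp : ∀ {a b : ℕ} (D : Matrix (Fin a) (Fin b) ℝ),
      (D.map (algebraMap ℝ (RatFunc ℝ))).map φ = (D.map (PowerSeries.C (R := ℝ))).map α := by
    intro a b D; ext i j : 2; simp only [Matrix.map_apply, hC]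
  set Z := Matrix.scalar (Fin n) (RatFunc.X : RatFunc ℝ) - A.map (algebraMap ℝ (RatFunc ℝ))
    with hZ
  set S : Matrix (Fin n) (Fin n) (PowerSeries ℝ) :=
    Matrix.of fun i j => PowerSeries.mk fun k => (A ^ k) i j with hS
  have hZφ : Z.map φ = w⁻¹ • (1 : Matrix (Fin n) (Fin n) (L)) -
      (A.map (PowerSeries.C (R := ℝ))).map α := by
    rw [hZ, Matrix.map_sub _ (map_sub φ), hcomp]
    congr 1
    ext i j : 2
    by_cases h : i = j <;> simp [h, Matrix.diagonal, hX]
  have h1 : Z.map φ * (w • S.map α) = 1 := by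
    have := congrArg α.mapMatrix (one_sub_smul_mul_geometric A)
    rw [map_mul, map_sub, map_one] at this
    have e : α.mapMatrix ((PowerSeries.X : PowerSeries ℝ) • A.map (PowerSeries.C (R := ℝ)))
        = w • (A.map (PowerSeries.C (R := ℝ))).map α := by
      ext i j : 2
      simp [hw]
    rw [e] at this
    rw [hZφ, Matrix.mul_smul, ← Matrix.smul_mul, smul_sub, smul_smul, mul_inv_cancel₀ hw0, one_smul]
    exact this
  have hdet : Z.det ≠ 0 := by
    intro h0
    have := congrArg Matrix.det h1
    rw [Matrix.det_mul, Matrix.det_one, ← RingHom.mapMatrix_apply, ← RingHom.map_det, h0, map_zero,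
      zero_mul] at this
    exact zero_ne_one this
  have h2 : Z⁻¹.map φ = w • S.map α := by
    have h3 : Z⁻¹.map φ * Z.map φ = 1 := by
      rw [← Matrix.map_mul, Matrix.nonsing_inv_mul _ (isUnit_iff_ne_zero.2 hdet),
        Matrix.map_one _ (map_zero φ) (map_one φ)]
    exact left_inv_eq_right_inv h3 h1
  rw [transferMatrix, Matrix.map_mul, Matrix.map_mul, h2, hcomp, hcomp, expansionAtInfinity_eq,
    Matrix.map_mul, Matrix.map_mul]
  congr 2
  ext i j : 2
  simp [hw, hS]

/-- A right-invertible system has a right inverse with delay over the power series in `w`. -/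
theorem RightInvertible.exists_expansion_mul {n m p : ℕ} {C : Matrix (Fin p) (Fin n) ℝ}
    {A : Matrix (Fin n) (Fin n) ℝ} {B : Matrix (Fin n) (Fin m) ℝ} (h : RightInvertible C A B) :
    ∃ (M : ℕ) (P : Matrix (Fin m) (Fin p) (PowerSeries ℝ)),
      expansionAtInfinity C A B * P = (PowerSeries.X : PowerSeries ℝ) ^ M • 1 := by
  let L := FractionRing (PowerSeries ℝ)
  obtain ⟨R, hR⟩ := h
  obtain ⟨φ, hX, hC⟩ := exists_ratFunc_hom L
  have hφ := map_transferMatrix C A B φ hX hC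
  set α := algebraMap (PowerSeries ℝ) (L) with hα
  have hinj : Function.Injective α := IsFractionRing.injective _ _
  have h1 : (expansionAtInfinity C A B).map α * R.map φ = 1 := by
    rw [← hφ, ← Matrix.map_mul, hR, Matrix.map_one _ (map_zero φ) (map_one φ)]
  obtain ⟨b, hb⟩ := IsLocalization.exist_integer_multiples_of_finite
    (nonZeroDivisors (PowerSeries ℝ)) (S := L) (fun ij : Fin m × Fin p => R.map φ ij.1 ij.2)
  choose P hP using hb
  obtain ⟨M, u, hu⟩ := IsDiscreteValuationRing.eq_unit_mul_pow_irreducible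
    (nonZeroDivisors.ne_zero b.2) (PowerSeries.X_irreducible (R := ℝ))
  refine ⟨M, (u⁻¹ : (PowerSeries ℝ)ˣ).1 • Matrix.of fun i j => P (i, j), ?_⟩
  have hPm : (Matrix.of fun i j => P (i, j)).map α = α b • R.map φ := by
    ext i j : 2
    have := hP (i, j)
    rw [Algebra.smul_def] at this
    exact this
  have h2 : expansionAtInfinity C A B * (Matrix.of fun i j => P (i, j)) = b.1 • 1 := by
    apply Matrix.map_injective hinj
    change (_ * _ : Matrix _ _ _).map α = (_ • (1 : Matrix _ _ _)).map α
    rw [Matrix.map_mul, hPm, Matrix.mul_smul, h1]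
    ext i j : 2
    by_cases hij : i = j <;> simp [hij]
  rw [Matrix.mul_smul, h2, smul_smul, hu, ← mul_assoc, u.inv_mul, one_mul]

/-- The orders of the infinite zeros are bounded by the delay of any right inverse. -/
theorem HasInfiniteZero.le_of_expansion_mul {n m p q M : ℕ} {C : Matrix (Fin p) (Fin n) ℝ}
    {A : Matrix (Fin n) (Fin n) ℝ} {B : Matrix (Fin n) (Fin m) ℝ} (h : HasInfiniteZero C A B q)
    {P : Matrix (Fin m) (Fin p) (PowerSeries ℝ)}
    (hP : expansionAtInfinity C A B * P = (PowerSeries.X : PowerSeries ℝ) ^ M • 1) : q ≤ M := by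
  obtain ⟨U, V, S, ⟨U, rfl⟩, ⟨V, rfl⟩, hS, hoff, -, i, j, hij, hq⟩ := h
  have h1 : S * (V⁻¹.1 * P * U⁻¹.1) = (PowerSeries.X : PowerSeries ℝ) ^ M • 1 := by
    rw [← hS]
    calc U.1 * expansionAtInfinity C A B * V.1 * (V⁻¹.1 * P * U⁻¹.1)
        = U.1 * (expansionAtInfinity C A B * (V.1 * V⁻¹.1) * P) * U⁻¹.1 := by
          simp only [Matrix.mul_assoc]
      _ = _ := by
          rw [V.mul_inv, Matrix.mul_one, hP, Matrix.mul_smul, Matrix.smul_mul, Matrix.mul_one,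
            U.mul_inv]
  have h2 := congrFun (congrFun h1 i) i
  rw [Matrix.mul_apply, Finset.sum_eq_single j (fun l _ hl => by
    rw [hoff i l (fun h => hl (Fin.ext (h.symm.trans hij))), zero_mul]) (by simp), hq,
    Matrix.smul_apply, Matrix.one_apply_eq, smul_eq_mul, mul_one] at h2
  have h3 : (PowerSeries.X : PowerSeries ℝ) ^ q ∣ PowerSeries.X ^ M := ⟨_, h2.symm⟩
  exact (pow_dvd_pow_iff PowerSeries.X_ne_zero PowerSeries.X_prime.not_isUnit).1 h3

open PowerSeries in
/-- The Smith form over `ℝ⟦X⟧` of a matrix with a right inverse over its fraction field,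
obtained from bases adapted to its range and its kernel. -/
theorem exists_smith_form {m p M : ℕ} {G : Matrix (Fin p) (Fin m) ℝ⟦X⟧}
    {P : Matrix (Fin m) (Fin p) ℝ⟦X⟧}
    (hP : G * P = (PowerSeries.X : ℝ⟦X⟧) ^ M • 1) :
    p ≤ m ∧ ∃ (U : Matrix (Fin p) (Fin p) ℝ⟦X⟧)
      (V : Matrix (Fin m) (Fin m) ℝ⟦X⟧) (e : Fin p → ℕ), IsUnit U ∧ IsUnit V ∧
      U * G * V = Matrix.of fun i j => if i.val = j.val then PowerSeries.X ^ e i else 0 := by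
  classical
  set f : (Fin m → ℝ⟦X⟧) →ₗ[ℝ⟦X⟧] (Fin p → ℝ⟦X⟧) := G.mulVecLin with hf
  have hXM : (PowerSeries.X : ℝ⟦X⟧) ^ M ≠ 0 := pow_ne_zero _ PowerSeries.X_ne_zero
  -- the range of `G` contains `X ^ M • ℝ⟦X⟧ ^ p`, so it has full rank
  have hrank : Module.finrank ℝ⟦X⟧ (LinearMap.range f) = Module.finrank ℝ⟦X⟧ (Fin p → ℝ⟦X⟧) := by
    refine le_antisymm (Submodule.finrank_le _) ?_
    have hmem : ∀ x : Fin p → ℝ⟦X⟧, (PowerSeries.X : ℝ⟦X⟧) ^ M • x ∈ LinearMap.range f := fun x =>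
      ⟨P *ᵥ x, by rw [hf, Matrix.mulVecLin_apply, Matrix.mulVec_mulVec, hP, Matrix.smul_mulVec,
        Matrix.one_mulVec]⟩
    refine LinearMap.finrank_le_finrank_of_injective
      (f := (LinearMap.lsmul ℝ⟦X⟧ (Fin p → ℝ⟦X⟧) ((PowerSeries.X : ℝ⟦X⟧) ^ M)).codRestrict _ hmem) ?_
    intro x y hxy
    have h1 : (PowerSeries.X : ℝ⟦X⟧) ^ M • x = (PowerSeries.X : ℝ⟦X⟧) ^ M • y := congrArg Subtype.val hxy
    exact smul_right_injective _ hXM h1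
  obtain ⟨b, a, c, hc⟩ := Submodule.exists_smith_normal_form_of_rank_eq (Pi.basisFun ℝ⟦X⟧ (Fin p)) hrank
  have ha : ∀ i, a i ≠ 0 := fun i h0 => c.ne_zero i (Subtype.ext (by rw [hc, h0, zero_smul]; rfl))
  choose e u hu using fun i =>
    IsDiscreteValuationRing.eq_unit_mul_pow_irreducible (ha i) (PowerSeries.X_irreducible (R := ℝ))
  let b' := b.unitsSMul u
  have hcb : ∀ i, (c i : Fin p → ℝ⟦X⟧) = (PowerSeries.X : ℝ⟦X⟧) ^ e i • b' i := fun i => by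
    rw [hc, Module.Basis.unitsSMul_apply, hu, Units.smul_def, smul_smul, mul_comm]
  -- lift the basis of the range and complete it by a basis of the kernel
  choose g hg using fun i => (c i).2
  let s : LinearMap.range f →ₗ[ℝ⟦X⟧] (Fin m → ℝ⟦X⟧) := c.constr ℝ⟦X⟧ g
  have hs : ∀ x, f (s x) = x := by
    intro x
    have : f ∘ₗ s = (LinearMap.range f).subtype := c.ext fun i => by
      simp [s, hg]
    exact LinearMap.congr_fun this x
  obtain ⟨k, bk⟩ := Submodule.basisOfPid (Pi.basisFun ℝ⟦X⟧ (Fin m)) (LinearMap.ker f)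
  let E : (LinearMap.range f × LinearMap.ker f) ≃ₗ[ℝ⟦X⟧] (Fin m → ℝ⟦X⟧) :=
    LinearEquiv.ofBijective (s.coprod (LinearMap.ker f).subtype) (by
      constructor
      · rw [injective_iff_map_eq_zero]
        rintro ⟨x, y⟩ hxy
        simp only [LinearMap.coprod_apply, Submodule.subtype_apply] at hxy
        have h1 := congrArg f hxy
        rw [map_add, hs, LinearMap.mem_ker.1 y.2, add_zero, map_zero] at h1
        have h2 : x = 0 := Subtype.ext h1
        rw [h2, map_zero, zero_add] at hxy
        exact Prod.ext h2 (Subtype.ext hxy)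
      · intro x
        refine ⟨(⟨f x, x, rfl⟩, ⟨x - s ⟨f x, x, rfl⟩, ?_⟩), ?_⟩
        · rw [LinearMap.mem_ker, map_sub, hs, sub_self]
        · simp)
  have hE : ∀ x y, E (x, y) = s x + y := fun _ _ => rfl
  let bE := (c.prod bk).map E
  have hcard : p + k = m := by
    have := Fintype.card_congr (bE.indexEquiv (Pi.basisFun ℝ⟦X⟧ (Fin m)))
    simpa using this
  subst hcard
  refine ⟨Nat.le_add_right _ _, ?_⟩
  let bV := bE.reindex finSumFinEquiv
  let _ := b'.invertibleToMatrix (Pi.basisFun ℝ⟦X⟧ (Fin p))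
  let _ := (Pi.basisFun ℝ⟦X⟧ (Fin (p + k))).invertibleToMatrix bV
  refine ⟨b'.toMatrix (Pi.basisFun ℝ⟦X⟧ (Fin p)), (Pi.basisFun ℝ⟦X⟧ (Fin (p + k))).toMatrix bV, e,
    isUnit_of_invertible _, isUnit_of_invertible _, ?_⟩
  have hG : G = LinearMap.toMatrix (Pi.basisFun ℝ⟦X⟧ (Fin (p + k))) (Pi.basisFun ℝ⟦X⟧ (Fin p)) f := by
    ext i j : 2
    simp [LinearMap.toMatrix_apply, hf]
  rw [hG, basis_toMatrix_mul_linearMap_toMatrix_mul_basis_toMatrix]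
  ext i j : 2
  rw [LinearMap.toMatrix_apply, Matrix.of_apply]
  refine Fin.addCases (fun j => ?_) (fun j => ?_) j
  · have h1 : f (bV (Fin.castAdd k j)) = (PowerSeries.X : ℝ⟦X⟧) ^ e j • b' j := by
      rw [← hcb, ← hs]
      simp [bV, bE, hE]
    rw [h1, map_smul, Module.Basis.repr_self, Finsupp.smul_single, Finsupp.single_apply]
    by_cases hij : j = i
    · subst hij; simp
    · rw [if_neg hij, if_neg]
      rw [Fin.val_castAdd]
      exact fun h => hij (Fin.ext h.symm)
  · have h1 : f (bV (Fin.natAdd p j)) = 0 := by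
      simp [bV, bE, hE]
    rw [h1, map_zero, if_neg]
    · rfl
    · rw [Fin.val_natAdd]; omega

/-- If no infinite zero has an order exceeding `nq`, a right-invertible system has a right
inverse with delay `nq`. -/
theorem RightInvertible.exists_expansion_mul_of_le {n m p nq : ℕ} {C : Matrix (Fin p) (Fin n) ℝ}
    {A : Matrix (Fin n) (Fin n) ℝ} {B : Matrix (Fin n) (Fin m) ℝ} (h : RightInvertible C A B)
    (hq : ∀ q, HasInfiniteZero C A B q → q ≤ nq) :
    ∃ P : Matrix (Fin m) (Fin p) (PowerSeries ℝ),
      expansionAtInfinity C A B * P = (PowerSeries.X : PowerSeries ℝ) ^ nq • 1 := by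
  obtain ⟨M, P₀, hP₀⟩ := h.exists_expansion_mul
  obtain ⟨hpm, U, V, e, hU, hV, hS⟩ := exists_smith_form hP₀
  have he : ∀ i, e i ≤ nq := fun i => hq _ ⟨U, V, _, hU, hV, hS,
    fun i j hij => by simp [hij], fun i j hij => Or.inr ⟨e i, by simp [hij]⟩,
    i, Fin.castLE hpm i, by simp, by simp⟩
  obtain ⟨U, rfl⟩ := hU
  set T : Matrix (Fin m) (Fin p) (PowerSeries ℝ) :=
    Matrix.of fun j i => if i.val = j.val then PowerSeries.X ^ (nq - e i) else 0 with hT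
  have hST : (U.1 * expansionAtInfinity C A B * V) * T =
      (PowerSeries.X : PowerSeries ℝ) ^ nq • 1 := by
    rw [hS]
    ext i j : 2
    rw [Matrix.mul_apply, Finset.sum_eq_single (Fin.castLE hpm i) (fun l _ hl => by
      rw [Matrix.of_apply, if_neg, zero_mul]
      exact fun h => hl (Fin.ext h.symm)) (by simp)]
    by_cases hij : i = j
    · subst hij
      simp [hT, ← pow_add, he]
    · have : ¬ j.val = i.val := fun h => hij (Fin.ext h.symm)
      simp [hT, hij, this]
  refine ⟨V * T * U.1, ?_⟩
  calc expansionAtInfinity C A B * (V * T * U.1)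
      = (U⁻¹.1 * U.1) * expansionAtInfinity C A B * (V * T * U.1) := by
        rw [U.inv_mul, Matrix.one_mul]
    _ = U⁻¹.1 * ((U.1 * expansionAtInfinity C A B * V) * T) * U.1 := by
        simp only [Matrix.mul_assoc]
    _ = _ := by
        rw [hST, Matrix.mul_smul, Matrix.smul_mul, Matrix.mul_one, U.inv_mul]

end Infinity

/-! ### Homogenizing pre-compensators -/

/-- A signal `Y 0` with shifts `Y 1, …, Y (nq - 1)` that obeys the output recursion of a system of
uniform rank is an output of this system. -/
theorem UniformRank.exists_trajectory {n p nq : ℕ} {A : Matrix (Fin n) (Fin n) ℝ}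
    {B : Matrix (Fin n) (Fin p) ℝ} {C : Matrix (Fin p) (Fin n) ℝ} (h : UniformRank C A B nq)
    {Φ : Fin nq → Matrix (Fin p) (Fin p) ℝ} (hΦ : C * A ^ nq = ∑ j : Fin nq, Φ j * (C * A ^ j.val))
    {Y : ℕ → ℕ → Fin p → ℝ} {v : ℕ → Fin p → ℝ}
    (hY : ∀ j k, j + 1 < nq → Y j (k + 1) = Y (j + 1) k)
    (hYv : ∀ k, Y (nq - 1) (k + 1) =
      ∑ j : Fin nq, Φ j *ᵥ Y j.val k + (C * A ^ (nq - 1) * B) *ᵥ v k) :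
    ∃ x : ℕ → Fin n → ℝ, (∀ k, x (k + 1) = A *ᵥ x k + B *ᵥ v k) ∧ ∀ k, C *ᵥ x k = Y 0 k := by
  obtain ⟨x₀, -, hx₀⟩ := h.exists_mem_span ⊤ (fun _ _ _ => trivial) (fun j => Y j 0)
  obtain ⟨hnq, h0, -⟩ := h
  let x : ℕ → Fin n → ℝ := fun k => Nat.rec x₀ (fun k x => A *ᵥ x + B *ᵥ v k) k
  have hx : ∀ k, x (k + 1) = A *ᵥ x k + B *ᵥ v k := fun k => rfl
  have key : ∀ k, ∀ j < nq, (C * A ^ j) *ᵥ x k = Y j k := by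
    intro k
    induction k with
    | zero => exact hx₀
    | succ k ih =>
      intro j hj
      rw [hx, Matrix.mulVec_add, Matrix.mulVec_mulVec, Matrix.mulVec_mulVec, Matrix.mul_assoc C,
        ← pow_succ]
      rcases Nat.lt_or_ge (j + 1) nq with h1 | h1
      · rw [ih _ h1, h0 j h1, Matrix.zero_mulVec, add_zero, hY j k h1]
      · obtain rfl : j = nq - 1 := by omega
        rw [Nat.sub_add_cancel hnq, hΦ, Matrix.sum_mulVec, hYv]
        congr 1
        refine Finset.sum_congr rfl fun l _ => ?_
        rw [← Matrix.mulVec_mulVec, ih l l.2]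
  exact ⟨x, hx, fun k => by simpa using key k 0 hnq⟩

/-- The Markov parameters `C A ^ k B` convolved with the coefficients of a right inverse with
delay `nq`: an input sequence `R 0 w, R 1 w, …` changes no output before time `nq`, and the output
at time `nq` by `w`. -/
theorem RightInvertible.exists_markov {n m p nq : ℕ} {C : Matrix (Fin p) (Fin n) ℝ}
    {A : Matrix (Fin n) (Fin n) ℝ} {B : Matrix (Fin n) (Fin m) ℝ} (h : RightInvertible C A B)
    (hq : ∀ q, HasInfiniteZero C A B q → q ≤ nq) :
    ∃ R : ℕ → Matrix (Fin m) (Fin p) ℝ, ∀ j,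
      ∑ i ∈ Finset.range (j + 1), C * A ^ (j - i) * B * R i = if j + 1 = nq then 1 else 0 := by
  obtain ⟨P, hP⟩ := h.exists_expansion_mul_of_le hq
  refine ⟨fun k => P.map (PowerSeries.coeff k), fun j => ?_⟩
  ext a b
  have h1 := congrArg (PowerSeries.coeff (j + 1)) (congrFun (congrFun hP a) b)
  rw [Matrix.mul_apply, map_sum] at h1
  have h2 : ∀ l, PowerSeries.coeff (j + 1) (expansionAtInfinity C A B a l * P l b) =
      ∑ i ∈ Finset.range (j + 1), (C * A ^ (j - i) * B) a l * PowerSeries.coeff i (P l b) := by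
    intro l
    rw [expansionAtInfinity, Matrix.of_apply, mul_assoc, PowerSeries.coeff_succ_X_mul, mul_comm,
      PowerSeries.coeff_mul, Finset.Nat.sum_antidiagonal_eq_sum_range_succ_mk]
    refine Finset.sum_congr rfl fun i _ => ?_
    rw [PowerSeries.coeff_mk, mul_comm]
  simp only [h2] at h1
  rw [Finset.sum_comm] at h1
  rw [Matrix.sum_apply]
  simp only [Matrix.mul_apply (N := P.map _), Matrix.map_apply]
  rw [h1, Matrix.smul_apply, smul_eq_mul]
  by_cases hab : a = b <;> by_cases hj : j + 1 = nq <;>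
    simp [hab, hj, PowerSeries.coeff_X_pow, Matrix.one_apply]

/-- A state and a plan of the next `nq` inputs. -/
abbrev PlanSpace (n m nq : ℕ) : Type := (Fin n → ℝ) × (Fin nq → Fin m → ℝ)

/-- The state predicted `j` steps ahead, if the planned inputs are applied (and zero after the
end of the plan). -/
def planState {n m : ℕ} (nq : ℕ) (A : Matrix (Fin n) (Fin n) ℝ) (B : Matrix (Fin n) (Fin m) ℝ) :
    ℕ → PlanSpace n m nq →ₗ[ℝ] (Fin n → ℝ)
  | 0 => LinearMap.fst ℝ _ _
  | j + 1 => A.mulVecLin ∘ₗ planState nq A B j +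
      if h : j < nq then B.mulVecLin ∘ₗ LinearMap.proj ⟨j, h⟩ ∘ₗ LinearMap.snd ℝ _ _ else 0

section Plan

variable {n m p nq : ℕ} (A : Matrix (Fin n) (Fin n) ℝ) (B : Matrix (Fin n) (Fin m) ℝ)

theorem planState_zero (s : PlanSpace n m nq) : planState nq A B 0 s = s.1 := rfl

theorem planState_succ {j : ℕ} (hj : j < nq) (s : PlanSpace n m nq) :
    planState nq A B (j + 1) s = A *ᵥ planState nq A B j s + B *ᵥ s.2 ⟨j, hj⟩ := by
  simp [planState, hj]

theorem planState_shift (hnq : 0 < nq) {s s' : PlanSpace n m nq}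
    (h1 : s'.1 = A *ᵥ s.1 + B *ᵥ s.2 ⟨0, hnq⟩)
    (h2 : ∀ i (hi : i + 1 < nq), s'.2 ⟨i, by omega⟩ = s.2 ⟨i + 1, hi⟩) {j : ℕ} (hj : j < nq) :
    planState nq A B j s' = planState nq A B (j + 1) s := by
  induction j with
  | zero => rw [planState_succ A B hnq, planState_zero, planState_zero, h1]
  | succ j ih =>
    rw [planState_succ A B (by omega : j < nq), ih (by omega), planState_succ A B hj, h2 j hj]

theorem planState_state (e : Fin n → ℝ) {j : ℕ} (hj : j ≤ nq) :
    planState nq A B j (e, 0) = (A ^ j) *ᵥ e := by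
  induction j with
  | zero => simp [planState_zero]
  | succ j ih =>
    rw [planState_succ A B hj, ih (by omega), Matrix.mulVec_mulVec, ← pow_succ']
    simp

theorem planState_inputs (R : ℕ → Matrix (Fin m) (Fin p) ℝ) (w : Fin p → ℝ) {j : ℕ} (hj : j ≤ nq) :
    planState nq A B j (0, fun i => R i *ᵥ w) =
      (∑ i ∈ Finset.range j, A ^ (j - 1 - i) * B * R i) *ᵥ w := by
  induction j with
  | zero => simp [planState_zero]
  | succ j ih =>
    rw [planState_succ A B hj, ih (by omega), Finset.sum_range_succ, Matrix.add_mulVec,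
      Matrix.mulVec_mulVec, Matrix.mulVec_mulVec, Matrix.mul_sum]
    congr 2
    · refine Finset.sum_congr rfl fun i hi => ?_
      have := Finset.mem_range.1 hi
      rw [show j + 1 - 1 - i = (j - 1 - i) + 1 by omega, pow_succ' A, Matrix.mul_assoc A,
        Matrix.mul_assoc A]
    · simp

end Plan

/-- A pre-compensator in coordinates, from linear maps on a finite-dimensional state space. -/
theorem exists_preCompensator {p : ℕ} (ag : Agent p) {S : Type*} [AddCommGroup S] [Module ℝ S]
    [FiniteDimensional ℝ S] (f : S →ₗ[ℝ] S) (fz : (Fin ag.q → ℝ) →ₗ[ℝ] S)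
    (fv : (Fin p → ℝ) →ₗ[ℝ] S) (g : S →ₗ[ℝ] (Fin ag.m → ℝ))
    (gv : (Fin p → ℝ) →ₗ[ℝ] (Fin ag.m → ℝ)) :
    ∃ (c : PreCompensator ag) (E : (Fin c.n → ℝ) ≃ₗ[ℝ] S),
      (∀ ξ z v, E (c.Ah *ᵥ ξ + c.Bh *ᵥ z + c.Eh *ᵥ v) = f (E ξ) + fz z + fv v) ∧
      ∀ ξ v, c.Ch *ᵥ ξ + c.Dh *ᵥ v = g (E ξ) + gv v := by
  let E := (Module.finBasis ℝ S).equivFun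
  refine ⟨{ n := Module.finrank ℝ S
            Ah := LinearMap.toMatrix' (E.toLinearMap ∘ₗ f ∘ₗ E.symm.toLinearMap)
            Bh := LinearMap.toMatrix' (E.toLinearMap ∘ₗ fz)
            Eh := LinearMap.toMatrix' (E.toLinearMap ∘ₗ fv)
            Ch := LinearMap.toMatrix' (g ∘ₗ E.symm.toLinearMap)
            Dh := LinearMap.toMatrix' gv }, E.symm, fun ξ z v => ?_, fun ξ v => ?_⟩
  · simp only [LinearMap.toMatrix'_mulVec, map_add, LinearMap.comp_apply, LinearEquiv.coe_coe,
      LinearEquiv.symm_apply_apply]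
  · simp only [LinearMap.toMatrix'_mulVec, LinearMap.comp_apply, LinearEquiv.coe_coe]

/-- The pre-compensator consists of an observer for the state of the agent, and of a plan of the
next `nq` inputs. The plan is revised at each step along the right inverse with delay `nq`, which
leaves the `nq` next outputs unchanged and gives the output after them the value prescribed by
the output recursion of the target model. The predictions differ from the real ones by linear
functions of the observer error, which make up the disturbance `ρ`. -/
theorem exists_homogenizes {p nq : ℕ} {ag : Agent p} (hag : ag.Admissible)
    (hq : ∀ q, HasInfiniteZero ag.C ag.A ag.B q → q ≤ nq) {T : TargetModel p}
    (hT : UniformRank T.C T.A T.B nq) (hO : ObservableIn T.C T.A nq) :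
    ∃ c : PreCompensator ag, c.Homogenizes T := by
  obtain ⟨R, hR⟩ := hag.rightInvertible.exists_markov hq
  obtain ⟨L, hL⟩ := hag.detectable_local
  obtain ⟨Φ, hΦ⟩ := hO.exists_recursion
  obtain ⟨hnq, -, ⟨Γ, hΓ⟩⟩ := id hT
  -- `W` is the gap between the prescribed and the planned output `nq` steps ahead
  let Y : ℕ → PlanSpace ag.n ag.m nq →ₗ[ℝ] (Fin p → ℝ) := fun j =>
    ag.C.mulVecLin ∘ₗ planState nq ag.A ag.B j
  let W : PlanSpace ag.n ag.m nq →ₗ[ℝ] (Fin p → ℝ) :=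
    (∑ j : Fin nq, (Φ j).mulVecLin ∘ₗ Y j) - Y nq
  -- the input and the next plan, as functions of the plan and of the correction
  let g0 : PlanSpace ag.n ag.m nq →ₗ[ℝ] (Fin ag.m → ℝ) :=
    LinearMap.proj ⟨0, hnq⟩ ∘ₗ LinearMap.snd ℝ _ _
  let g1 : (Fin p → ℝ) →ₗ[ℝ] (Fin ag.m → ℝ) := (R 0).mulVecLin
  let q0 : PlanSpace ag.n ag.m nq →ₗ[ℝ] (Fin nq → Fin ag.m → ℝ) := LinearMap.pi fun i =>
    if h : i.val + 1 < nq then LinearMap.proj ⟨i.val + 1, h⟩ ∘ₗ LinearMap.snd ℝ _ _ else 0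
  let q1 : (Fin p → ℝ) →ₗ[ℝ] (Fin nq → Fin ag.m → ℝ) := LinearMap.pi fun i =>
    if i.val + 1 < nq then (R (i.val + 1)).mulVecLin else 0
  let G : (Fin p → ℝ) →ₗ[ℝ] (Fin p → ℝ) := (T.C * T.A ^ (nq - 1) * T.B).mulVecLin
  obtain ⟨c, E, hc1, hc2⟩ := exists_preCompensator ag
    (LinearMap.prod ((ag.A - L * ag.Cm).mulVecLin ∘ₗ LinearMap.fst ℝ _ _ +
      ag.B.mulVecLin ∘ₗ (g0 + g1 ∘ₗ W)) (q0 + q1 ∘ₗ W))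
    (LinearMap.prod L.mulVecLin 0)
    (LinearMap.prod (ag.B.mulVecLin ∘ₗ g1 ∘ₗ G) (q1 ∘ₗ G)) (g0 + g1 ∘ₗ W) (g1 ∘ₗ G)
  let D : Matrix (Fin p) (Fin ag.n) ℝ :=
    ag.C * ag.A ^ nq - ∑ j : Fin nq, Φ j * (ag.C * ag.A ^ j.val)
  refine ⟨c, ag.n, ag.A - L * ag.Cm, Γ⁻¹.1 * D, hL, fun x ξ v hx hξ => ?_⟩
  set s : ℕ → PlanSpace ag.n ag.m nq := fun k => E (ξ k) with hs
  set w : ℕ → Fin p → ℝ := fun k => W (s k) + G (v k) with hw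
  set u : ℕ → Fin ag.m → ℝ := fun k => (s k).2 ⟨0, hnq⟩ + R 0 *ᵥ w k with hu
  have hxu : ∀ k, x (k + 1) = ag.A *ᵥ x k + ag.B *ᵥ u k := by
    intro k
    rw [hx, hc2]
    simp only [hu, hw, g0, g1, LinearMap.add_apply, LinearMap.comp_apply, Matrix.mulVecLin_apply,
      LinearMap.proj_apply, LinearMap.snd_apply, Matrix.mulVec_add, hs, add_assoc]
  have hsucc : ∀ k, s (k + 1) = E (c.Ah *ᵥ ξ k + c.Bh *ᵥ (ag.Cm *ᵥ x k) + c.Eh *ᵥ v k) :=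
    fun k => by rw [← hξ]
  have hs1 : ∀ k, (s (k + 1)).1 =
      (ag.A - L * ag.Cm) *ᵥ (s k).1 + ag.B *ᵥ u k + L *ᵥ (ag.Cm *ᵥ x k) := by
    intro k
    rw [hsucc, hc1]
    simp only [hu, hw, g0, g1, LinearMap.add_apply, LinearMap.comp_apply, Matrix.mulVecLin_apply,
      LinearMap.proj_apply, LinearMap.snd_apply, Matrix.mulVec_add, hs, LinearMap.prod_apply,
      Function.prod, Prod.fst_add, LinearMap.fst_apply]
    abel
  have hs2 : ∀ k i (hi : i + 1 < nq),
      (s (k + 1)).2 ⟨i, by omega⟩ = (s k).2 ⟨i + 1, hi⟩ + R (i + 1) *ᵥ w k := by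
    intro k i hi
    rw [hsucc, hc1]
    simp only [hw, q0, q1, LinearMap.add_apply, LinearMap.comp_apply, Matrix.mulVecLin_apply,
      LinearMap.proj_apply, LinearMap.snd_apply, Matrix.mulVec_add, hs, LinearMap.prod_apply,
      Function.prod, Prod.snd_add, LinearMap.pi_apply, Pi.add_apply, hi, dif_pos, if_pos,
      LinearMap.zero_apply, zero_add, add_assoc]
  -- the observer error
  set e : ℕ → Fin ag.n → ℝ := fun k => x k - (s k).1 with he
  have he1 : ∀ k, e (k + 1) = (ag.A - L * ag.Cm) *ᵥ e k := by
    intro k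
    simp only [he]
    rw [hxu, hs1, Matrix.mulVec_sub, Matrix.sub_mulVec, Matrix.sub_mulVec, Matrix.mulVec_mulVec]
    abel
  -- outputs predicted from the real state
  set Z : ℕ → ℕ → Fin p → ℝ := fun j k => Y j (x k, (s k).2) with hZ
  have hZs : ∀ j ≤ nq, ∀ k, Z j k = Y j (s k) + (ag.C * ag.A ^ j) *ᵥ e k := by
    intro j hj k
    have h1 : (x k, (s k).2) = s k + (e k, 0) := by
      ext <;> simp [he]
    simp only [hZ]
    rw [h1, map_add]
    congr 1
    simp only [Y, LinearMap.comp_apply, Matrix.mulVecLin_apply]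
    rw [planState_state _ _ _ hj, Matrix.mulVec_mulVec]
  have hZshift : ∀ j < nq, ∀ k, Z j (k + 1) = Z (j + 1) k + if j + 1 = nq then w k else 0 := by
    intro j hj k
    have h1 := planState_shift ag.A ag.B hnq
      (s := (x k, (s k).2) + (0, fun i : Fin nq => R i *ᵥ w k)) (s' := (x (k + 1), (s (k + 1)).2))
      (by simp only [Prod.fst_add, Prod.snd_add, Pi.add_apply, add_zero]; exact hxu k)
      (fun i hi => by
        simp only [Prod.snd_add, Pi.add_apply]; exact hs2 k i hi) hj
    simp only [hZ, Y, LinearMap.comp_apply, Matrix.mulVecLin_apply]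
    rw [h1, map_add, Matrix.mulVec_add, planState_inputs _ _ _ _ (by omega : j + 1 ≤ nq),
      Matrix.mulVec_mulVec]
    congr 1
    rw [Matrix.mul_sum]
    have h2 := hR j
    simp only [Matrix.mul_assoc] at h2 ⊢
    rw [Nat.add_sub_cancel, h2]
    split_ifs <;> simp
  have hΓi : (T.C * T.A ^ (nq - 1) * T.B) * (Γ⁻¹.1 * D) = D := by
    rw [← hΓ, ← Matrix.mul_assoc, Γ.mul_inv, Matrix.one_mul]
  obtain ⟨xh, hxh1, hxh2⟩ := hT.exists_trajectory hΦ (Y := Z)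
    (v := fun k => v k + (Γ⁻¹.1 * D) *ᵥ e k)
    (fun j k hj => by rw [hZshift j (by omega), if_neg (by omega), add_zero])
    (fun k => by
      rw [hZshift _ (by omega), if_pos (by omega), Nat.sub_add_cancel hnq, hZs nq le_rfl,
        Matrix.mulVec_add, Matrix.mulVec_mulVec, hΓi]
      have h1 : ∑ j : Fin nq, Φ j *ᵥ Z j.val k =
          ∑ j : Fin nq, Φ j *ᵥ Y j (s k) +
            (∑ j : Fin nq, Φ j * (ag.C * ag.A ^ j.val)) *ᵥ e k := by
        rw [Matrix.sum_mulVec, ← Finset.sum_add_distrib]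
        refine Finset.sum_congr rfl fun j _ => ?_
        rw [hZs j j.2.le, Matrix.mulVec_add, Matrix.mulVec_mulVec]
      have h2 : w k = ∑ j : Fin nq, Φ j *ᵥ Y j (s k) - Y nq (s k) +
          (T.C * T.A ^ (nq - 1) * T.B) *ᵥ v k := by
        simp only [hw, W, G, LinearMap.sub_apply, LinearMap.sum_apply, LinearMap.comp_apply,
          Matrix.mulVecLin_apply]
      rw [h1, h2, Matrix.sub_mulVec]
      abel)
  exact ⟨xh, e, hxh1, he1, fun k => (hxh2 k).symm⟩

/-! ### Invariant zeros and invertibility of observable systems of uniform rank -/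

section Uniform

variable {n p nq : ℕ} {A : Matrix (Fin n) (Fin n) ℝ} {B : Matrix (Fin n) (Fin p) ℝ}
  {C : Matrix (Fin p) (Fin n) ℝ}

theorem ObservableIn.eq_zero_of_complex (hO : ObservableIn C A nq) {x : Fin n → ℂ}
    (hx : ∀ l < nq, (C.map (algebraMap ℝ ℂ) * A.map (algebraMap ℝ ℂ) ^ l) *ᵥ x = 0) : x = 0 := by
  have key : ∀ φ : ℂ →ₗ[ℝ] ℝ, (fun i => φ (x i)) = 0 := by
    intro φ
    refine hO _ fun l hl => ?_
    have h1 := hx l hl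
    rw [← Matrix.map_pow, ← Matrix.map_mul] at h1
    ext i
    have h2 := congrArg φ (congrFun h1 i)
    simp only [Matrix.mulVec, dotProduct, Pi.zero_apply, map_sum, map_zero, Matrix.map_apply,
      ← Algebra.smul_def, map_smul, smul_eq_mul] at h2 ⊢
    exact h2
  ext i
  exact Complex.ext (congrFun (key Complex.reLm) i) (congrFun (key Complex.imLm) i)

/-- The system matrix of an observable system of uniform rank is injective at every point. -/
theorem UniformRank.not_isInvariantZero (h : UniformRank C A B nq) (hO : ObservableIn C A nq)
    (z : ℂ) : ¬ IsInvariantZero C A B z := by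
  have hker : ∀ z v, systemMatrix C A B z *ᵥ v = 0 → v = 0 := by
    intro z v hv
    rw [← Sum.elim_comp_inl_inr v, systemMatrix_mulVec_eq_zero] at hv
    obtain ⟨h1, h2⟩ := h.kernel_systemMatrix hv.1 hv.2
    have hx := hO.eq_zero_of_complex h1
    obtain ⟨Γi, -, hΓ⟩ := isUnit_iff_exists.1 h.2.2
    rw [hx, Matrix.mulVec_zero, zero_add] at h2
    have h3 := congrArg (Γi.map (algebraMap ℝ ℂ) *ᵥ ·) h2
    simp only [Matrix.mulVec_mulVec, Matrix.mulVec_zero] at h3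
    rw [← Matrix.map_mul, hΓ, Matrix.map_one _ (map_zero _) (map_one _), Matrix.one_mulVec] at h3
    rw [← Sum.elim_comp_inl_inr v, hx, h3, Sum.elim_zero_zero]
  rintro ⟨w, hw⟩
  have hrank : ∀ z, (systemMatrix C A B z).rank = n + p := by
    intro z
    have e1 := (systemMatrix C A B z).mulVecLin.finrank_range_add_finrank_ker
    have k1 : LinearMap.ker (systemMatrix C A B z).mulVecLin = ⊥ :=
      LinearMap.ker_eq_bot'.2 fun v h => hker z v h
    rw [k1, finrank_bot] at e1
    rw [Matrix.rank]
    simpa using e1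
  rw [hrank, hrank] at hw
  exact lt_irrefl _ hw

/-- From the output recursion, `(z ^ nq - ∑ Φ_j z ^ j) (C (z - A)⁻¹ B) = C A ^ (nq - 1) B`. -/
theorem UniformRank.exists_transferMatrix_inverse (h : UniformRank C A B nq)
    (hO : ObservableIn C A nq) : ∃ R, R * transferMatrix C A B = 1 := by
  obtain ⟨Φ, hΦ⟩ := hO.exists_recursion
  obtain ⟨hnq, h0, hΓ⟩ := h
  obtain ⟨Γi, -, hΓi⟩ := isUnit_iff_exists.1 hΓ
  set α := algebraMap ℝ (RatFunc ℝ) with hα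
  set Z := Matrix.scalar (Fin n) (RatFunc.X : RatFunc ℝ) - A.map α with hZ
  have hdet : Z.det ≠ 0 := by
    have h1 : Z = (algebraMap (Polynomial ℝ) (RatFunc ℝ)).mapMatrix A.charmatrix := by
      ext i j
      by_cases hij : i = j
      · subst hij
        simp [hZ, hα, RatFunc.algebraMap_eq_C]
      · simp [hZ, hα, hij, RatFunc.algebraMap_eq_C]
    rw [h1, ← RingHom.map_det, ← Matrix.charpoly, Ne,
      map_eq_zero_iff _ (RatFunc.algebraMap_injective ℝ)]
    exact A.charpoly_monic.ne_zero
  have hAZ : A.map α * Z⁻¹ = (RatFunc.X : RatFunc ℝ) • Z⁻¹ - 1 := by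
    rw [← Matrix.mul_nonsing_inv Z (isUnit_iff_ne_zero.2 hdet), hZ, Matrix.sub_mul,
      Matrix.scalar_apply, ← Matrix.smul_one_eq_diagonal, Matrix.smul_mul, Matrix.one_mul]
    abel
  set G := transferMatrix C A B with hG
  let F : ℕ → Matrix (Fin p) (Fin p) (RatFunc ℝ) := fun j =>
    (C * A ^ j).map α * Z⁻¹ * B.map α
  have hF : ∀ j, F (j + 1) = (RatFunc.X : RatFunc ℝ) • F j - (C * A ^ j * B).map α := by
    intro j
    simp only [F]
    rw [pow_succ, ← Matrix.mul_assoc, Matrix.map_mul (L := C * A ^ j), Matrix.mul_assoc _ _ Z⁻¹,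
      hAZ, Matrix.mul_sub, Matrix.sub_mul, Matrix.mul_one, ← Matrix.map_mul, Matrix.mul_smul,
      Matrix.smul_mul]
  have hFj : ∀ j < nq, F j = (RatFunc.X : RatFunc ℝ) ^ j • G := by
    intro j
    induction j with
    | zero => intro _; simp [F, hG, transferMatrix, hZ, hα]
    | succ j ih =>
      intro hj
      rw [hF, ih (by omega), h0 j hj, Matrix.map_zero _ (map_zero α), sub_zero, smul_smul, pow_succ']
  have h1 : F nq = (RatFunc.X : RatFunc ℝ) ^ nq • G - (C * A ^ (nq - 1) * B).map α := by
    have := hF (nq - 1)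
    rw [hFj (nq - 1) (by omega), smul_smul, ← pow_succ', Nat.sub_add_cancel hnq] at this
    exact this
  have h2 : F nq = (∑ j : Fin nq, (RatFunc.X : RatFunc ℝ) ^ j.val • (Φ j).map α) * G := by
    simp only [F]
    have : (C * A ^ nq).map α = ∑ j : Fin nq, (Φ j).map α * (C * A ^ j.val).map α := by
      rw [hΦ]
      ext i j
      simp only [Matrix.map_apply, Matrix.sum_apply, map_sum]
      refine Finset.sum_congr rfl fun l _ => ?_
      rw [← Matrix.map_mul, Matrix.map_apply]
    rw [this, Matrix.sum_mul, Matrix.sum_mul, Matrix.sum_mul]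
    refine Finset.sum_congr rfl fun j _ => ?_
    have h3 := hFj j j.2
    simp only [F] at h3
    rw [Matrix.mul_assoc, Matrix.mul_assoc, ← Matrix.mul_assoc _ Z⁻¹, h3, Matrix.mul_smul,
      Matrix.smul_mul]
  refine ⟨Γi.map α * ((RatFunc.X : RatFunc ℝ) ^ nq • 1 -
    ∑ j : Fin nq, (RatFunc.X : RatFunc ℝ) ^ j.val • (Φ j).map α), ?_⟩
  rw [Matrix.mul_assoc, Matrix.sub_mul, ← h2, h1, Matrix.smul_mul, Matrix.one_mul, sub_sub_cancel,
    ← Matrix.map_mul, hΓi, Matrix.map_one _ (map_zero α) (map_one α)]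

end Uniform

/-! ### Observability in finitely many steps -/

section Observability

variable {n p : ℕ} {C : Matrix (Fin p) (Fin n) ℝ} {A : Matrix (Fin n) (Fin n) ℝ}

/-- By the Cayley–Hamilton theorem, `n` steps suffice for observability. -/
theorem Observable.observableIn (h : Observable C A) : ObservableIn C A n := by
  intro x hx
  rcases Nat.eq_zero_or_pos n with rfl | hn
  · exact Subsingleton.elim _ _
  refine h x fun l => ?_
  rw [Matrix.pow_eq_aeval_mod_charpoly, Polynomial.aeval_eq_sum_range' (n := n)]
  · rw [Matrix.mul_sum, Matrix.sum_mulVec]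
    refine Finset.sum_eq_zero fun i hi => ?_
    rw [Matrix.mul_smul, Matrix.smul_mulVec, hx i (Finset.mem_range.1 hi), smul_zero]
  · have hd : A.charpoly.natDegree = n := by simp
    refine (Polynomial.natDegree_modByMonic_lt _ A.charpoly_monic fun h1 => ?_).trans_eq hd
    rw [h1, Polynomial.natDegree_one] at hd
    exact hn.ne hd

theorem ObservableIn.mono {k l : ℕ} (h : ObservableIn C A k) (hkl : k ≤ l) : ObservableIn C A l :=
  fun x hx => h x fun j hj => hx j (hj.trans_le hkl)

theorem Observable.observableIn_of_index_le (h : Observable C A) {k : ℕ}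
    (hk : observabilityIndex C A ≤ k) : ObservableIn C A k :=
  ObservableIn.mono (Nat.sInf_mem (s := {k | ObservableIn C A k}) ⟨n, h.observableIn⟩) hk

end Observability

/-! ### Existence of target models -/

/-- A linear feedback that agrees with `F₀` on `S 0` and moves down one step in an increasing chain
of subspaces, each of which can be steered pointwise into its predecessor. -/
theorem exists_feedback_chain {K X U : Type*} [Field K] [AddCommGroup X] [Module K X]
    [AddCommGroup U] [Module K U] (f : X →ₗ[K] X) (b : U →ₗ[K] X) (S : ℕ → Submodule K X)
    (hmono : Monotone S) (hS : ∀ j, ∀ x ∈ S (j + 1), ∃ u, f x + b u ∈ S j) (F₀ : X →ₗ[K] U)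
    (h₀ : ∀ x ∈ S 0, f x + b (F₀ x) ∈ S 0) (k : ℕ) :
    ∃ F : X →ₗ[K] U, (∀ x ∈ S 0, F x = F₀ x) ∧ ∀ j < k, ∀ x ∈ S (j + 1), f x + b (F x) ∈ S j := by
  induction k with
  | zero => exact ⟨F₀, fun _ _ => rfl, fun j hj => absurd hj (by omega)⟩
  | succ k ih =>
    obtain ⟨F, hF0, hF⟩ := ih
    -- a linear choice of inputs on `S (k + 1)`
    obtain ⟨G, hG⟩ : ∃ G : X →ₗ[K] U, ∀ x ∈ S (k + 1), f x + b (G x) ∈ S k := by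
      let β := Module.Basis.ofVectorSpace K (S (k + 1))
      choose g hg using fun i => hS k (β i) (β i).2
      obtain ⟨G, hG⟩ := LinearMap.exists_extend (β.constr K g)
      refine ⟨G, fun x hx => ?_⟩
      have h1 : (S k).mkQ ∘ₗ (f + b ∘ₗ G) ∘ₗ (S (k + 1)).subtype = 0 := by
        refine β.ext fun i => ?_
        have h2 : G (β i) = g i := by
          have := LinearMap.congr_fun hG (β i)
          simpa using this
        simp only [LinearMap.comp_apply, LinearMap.add_apply, Submodule.subtype_apply, h2,
          LinearMap.zero_apply]
        exact (Submodule.Quotient.mk_eq_zero _).2 (hg i)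
      have h2 := LinearMap.congr_fun h1 ⟨x, hx⟩
      exact (Submodule.Quotient.mk_eq_zero _).1 h2
    obtain ⟨P, hP⟩ := LinearMap.exists_leftInverse_of_injective (S k).subtype (S k).ker_subtype
    have hP' : ∀ x ∈ S k, (P x : X) = x := fun x hx =>
      congrArg Subtype.val (LinearMap.congr_fun hP ⟨x, hx⟩)
    let F' : X →ₗ[K] U := F ∘ₗ (S k).subtype ∘ₗ P + G ∘ₗ (LinearMap.id - (S k).subtype ∘ₗ P)
    have hF' : ∀ x, F' x = F (P x) + G (x - P x) := fun x => rfl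
    have hk : ∀ x ∈ S k, F' x = F x := fun x hx => by
      rw [hF', hP' x hx, sub_self, map_zero, add_zero]
    refine ⟨F', fun x hx => by rw [hk x (hmono (Nat.zero_le k) hx), hF0 x hx], fun j hj x hx => ?_⟩
    rcases Nat.lt_succ_iff_lt_or_eq.1 hj with h1 | rfl
    · rw [hk x (hmono (by omega : j + 1 ≤ k) hx)]; exact hF j h1 x hx
    · have e1 : f (P x) + b (F (P x)) ∈ S j := by
        cases j with
        | zero => rw [hF0 _ (P x).2]; exact h₀ _ (P x).2
        | succ i => exact hmono (Nat.le_succ i) (hF i (by omega) _ (P x).2)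
      have e2 : f (x - P x) + b (G (x - P x)) ∈ S j :=
        hG _ (Submodule.sub_mem _ hx (hmono (Nat.le_succ j) (P x).2))
      have e3 : f x + b (F' x) = (f (P x) + b (F (P x))) + (f (x - P x) + b (G (x - P x))) := by
        rw [hF', map_add b, map_sub f]; abel
      rw [e3]
      exact Submodule.add_mem _ e1 e2

/-- The characteristic polynomial is multiplicative along an invariant subspace. -/
theorem charpoly_eq_restrict_mul_mapQ {X : Type*} [AddCommGroup X] [Module ℝ X]
    [FiniteDimensional ℝ X] (f : X →ₗ[ℝ] X) (V : Submodule ℝ X) (hV : V ≤ V.comap f) :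
    f.charpoly = (f.restrict hV).charpoly * (V.mapQ V f hV).charpoly := by
  refine Polynomial.funext fun t => ?_
  rw [Polynomial.eval_mul, LinearMap.eval_charpoly, LinearMap.eval_charpoly,
    LinearMap.eval_charpoly]
  have hV' : V ≤ V.comap (algebraMap ℝ (Module.End ℝ X) t - f) := fun x hx =>
    V.sub_mem (V.smul_mem t hx) (hV hx)
  rw [LinearMap.det_eq_det_mul_det V _ hV']
  congr 2
  ext x
  rfl

/-- If `f` restricts to `A` along an injection `O` and some power of `f` maps into the range of `O`,
then the characteristic polynomial of `f` is that of `A` times a power of `X`. -/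
theorem exists_charpoly_eq_mul_X_pow {X Y : Type*} [AddCommGroup X] [Module ℝ X]
    [FiniteDimensional ℝ X] [AddCommGroup Y] [Module ℝ Y] [FiniteDimensional ℝ Y]
    (f : X →ₗ[ℝ] X) (A : Y →ₗ[ℝ] Y) (O : Y →ₗ[ℝ] X) (hO : Function.Injective O)
    (hfO : ∀ y, f (O y) = O (A y)) (k : ℕ) (hk : ∀ x, (f ^ k) x ∈ LinearMap.range O) :
    ∃ l : ℕ, f.charpoly = A.charpoly * Polynomial.X ^ l := by
  have hV : LinearMap.range O ≤ (LinearMap.range O).comap f := by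
    rintro _ ⟨y, rfl⟩
    exact ⟨A y, (hfO y).symm⟩
  refine ⟨Module.finrank ℝ (X ⧸ LinearMap.range O), ?_⟩
  rw [charpoly_eq_restrict_mul_mapQ f _ hV]
  congr 1
  · let E := LinearEquiv.ofInjective O hO
    have : f.restrict hV = E.conj A := by
      refine LinearMap.ext fun x => ?_
      obtain ⟨y, rfl⟩ := E.surjective x
      refine Subtype.ext ?_
      rw [LinearEquiv.conj_apply_apply, E.symm_apply_apply]
      exact hfO y
    rw [this, LinearEquiv.charpoly_conj]
  · refine IsNilpotent.charpoly_eq_X_pow_finrank ⟨k, ?_⟩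
    rw [← Submodule.mapQ_pow]
    ext x
    exact (Submodule.Quotient.mk_eq_zero _).2 (hk x)

/-- The shift on the windows `(y 0, …, y (nq - 1))` of a signal, with a zero new last entry. -/
def windowShift (nq p : ℕ) : (Fin nq → Fin p → ℝ) →ₗ[ℝ] (Fin nq → Fin p → ℝ) :=
  LinearMap.pi fun j => if h : j.val + 1 < nq then LinearMap.proj ⟨j.val + 1, h⟩ else 0

/-- The window of the first `nq` outputs of the pair `(C, A)`. -/
def outputWindow {r p : ℕ} (C : Matrix (Fin p) (Fin r) ℝ) (A : Matrix (Fin r) (Fin r) ℝ) (nq : ℕ) :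
    (Fin r → ℝ) →ₗ[ℝ] (Fin nq → Fin p → ℝ) :=
  LinearMap.pi fun j => (C * A ^ j.val).mulVecLin

/-- Some linear continuation rule extends the windows of the outputs of `(C, A)` correctly, and
turns every window into such an output window after `nq` steps. The chain of subspaces behind it
consists of the windows whose entries from the `j`-th on are outputs of `(C, A)`. -/
theorem exists_continuation {r p nq : ℕ} (C : Matrix (Fin p) (Fin r) ℝ)
    (A : Matrix (Fin r) (Fin r) ℝ) (hnq : 0 < nq) (hO : ObservableIn C A nq) :
    ∃ Φ : (Fin nq → Fin p → ℝ) →ₗ[ℝ] (Fin p → ℝ),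
      (∀ x, Φ (outputWindow C A nq x) = (C * A ^ nq) *ᵥ x) ∧
      ∀ x, ((windowShift nq p + LinearMap.single ℝ (fun _ : Fin nq => Fin p → ℝ) ⟨nq - 1, by omega⟩ ∘ₗ Φ)
        ^ nq) x ∈ LinearMap.range (outputWindow C A nq) := by
  set N := windowShift nq p with hN
  set b : (Fin p → ℝ) →ₗ[ℝ] (Fin nq → Fin p → ℝ) :=
    LinearMap.single ℝ (fun _ : Fin nq => Fin p → ℝ) ⟨nq - 1, by omega⟩ with hb
  set O := outputWindow C A nq with hOdef
  have hOa : ∀ x j, O x j = (C * A ^ j.val) *ᵥ x := fun x j => rfl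
  have hNb : ∀ x u j, (N x + b u) j = if h : j.val + 1 < nq then x ⟨j.val + 1, h⟩ else u := by
    intro x u j
    have h1 : N x j = if h : j.val + 1 < nq then x ⟨j.val + 1, h⟩ else 0 := by
      simp only [hN, windowShift, LinearMap.pi_apply]
      split_ifs <;> rfl
    rw [Pi.add_apply, h1, hb, LinearMap.single_apply]
    by_cases h : j.val + 1 < nq
    · rw [dif_pos h, dif_pos h, Pi.single_eq_of_ne, add_zero]
      intro h2
      rw [h2] at h
      simp at h
      omega
    · rw [dif_neg h, dif_neg h, zero_add]
      have : j = ⟨nq - 1, by omega⟩ := Fin.ext (by have := j.2; simp; omega)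
      rw [this, Pi.single_eq_same]
  have hOinj : LinearMap.ker O = ⊥ := LinearMap.ker_eq_bot'.2 fun x hx =>
    hO x fun l hl => congrFun hx ⟨l, hl⟩
  obtain ⟨L, hL⟩ := LinearMap.exists_leftInverse_of_injective O hOinj
  have hLO : ∀ x, L (O x) = x := fun x => LinearMap.congr_fun hL x
  have hstep : ∀ x, N (O x) + b ((C * A ^ nq) *ᵥ x) = O (A *ᵥ x) := by
    intro x
    funext j
    rw [hNb, hOa, Matrix.mulVec_mulVec, Matrix.mul_assoc, ← pow_succ]
    split_ifs with h
    · rfl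
    · rw [show j.val + 1 = nq by have := j.2; omega]
  let S : ℕ → Submodule ℝ (Fin nq → Fin p → ℝ) := fun j =>
    { carrier := {x | ∃ x₀, ∀ i : Fin nq, j ≤ i.val → x i = (C * A ^ (i.val - j)) *ᵥ x₀}
      add_mem' := by
        rintro x y ⟨x₀, hx⟩ ⟨y₀, hy⟩
        exact ⟨x₀ + y₀, fun i hi => by rw [Pi.add_apply, hx i hi, hy i hi, Matrix.mulVec_add]⟩
      zero_mem' := ⟨0, fun i _ => by rw [Matrix.mulVec_zero]; rfl⟩
      smul_mem' := by
        rintro t x ⟨x₀, hx⟩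
        exact ⟨t • x₀, fun i hi => by rw [Pi.smul_apply, hx i hi, Matrix.mulVec_smul]⟩ }
  have hS0 : ∀ x, x ∈ S 0 ↔ x ∈ LinearMap.range O := by
    intro x
    constructor
    · rintro ⟨x₀, hx⟩
      exact ⟨x₀, funext fun i => (hx i (Nat.zero_le _)).symm⟩
    · rintro ⟨x₀, rfl⟩
      exact ⟨x₀, fun i _ => rfl⟩
  obtain ⟨F, hF0, hF⟩ := exists_feedback_chain N b S
    (monotone_nat_of_le_succ fun j => by
      rintro x ⟨x₀, hx⟩
      refine ⟨A *ᵥ x₀, fun i hi => ?_⟩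
      rw [hx i (by omega), Matrix.mulVec_mulVec, Matrix.mul_assoc, ← pow_succ,
        show i.val - (j + 1) + 1 = i.val - j by omega])
    (fun j => by
      rintro x ⟨x₀, hx⟩
      refine ⟨(C * A ^ (nq - 1 - j)) *ᵥ x₀, x₀, fun i hi => ?_⟩
      rw [hNb]
      split_ifs with h
      · rw [hx _ (by simp; omega)]
        simp
      · rw [show i.val = nq - 1 by have := i.2; omega])
    ((C * A ^ nq).mulVecLin ∘ₗ L)
    (fun x hx => by
      rw [hS0] at hx ⊢
      obtain ⟨x₀, rfl⟩ := hx
      rw [LinearMap.comp_apply, hLO, Matrix.mulVecLin_apply, hstep]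
      exact ⟨_, rfl⟩) nq
  refine ⟨F, fun x => ?_, fun x => ?_⟩
  · rw [hF0 _ ((hS0 _).2 ⟨x, rfl⟩), LinearMap.comp_apply, hLO, Matrix.mulVecLin_apply]
  · have key : ∀ k ≤ nq, ((N + b ∘ₗ F) ^ k) x ∈ S (nq - k) := by
      intro k
      induction k with
      | zero => intro _; exact ⟨0, fun i hi => absurd i.2 (by omega)⟩
      | succ k ih =>
        intro hk
        rw [pow_succ', Module.End.mul_apply]
        refine hF _ (by omega) _ ?_
        rw [show nq - (k + 1) + 1 = nq - k by omega]
        exact ih (by omega)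
    have := key nq le_rfl
    rw [Nat.sub_self, hS0] at this
    exact this

/-- The target model is the shift on output windows, closed by a continuation rule; its inputs
are added to the new last entry. -/
theorem exists_remodels {p nq : ℕ} {exo : Exosystem p} (hnq : 0 < nq)
    (hO : ObservableIn exo.C exo.A nq) : ∃ T : TargetModel p, T.Remodels exo nq := by
  obtain ⟨Φ, hΦ1, hΦ2⟩ := exists_continuation exo.C exo.A hnq hO
  set b : (Fin p → ℝ) →ₗ[ℝ] (Fin nq → Fin p → ℝ) :=
    LinearMap.single ℝ (fun _ : Fin nq => Fin p → ℝ) ⟨nq - 1, by omega⟩ with hb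
  set O := outputWindow exo.C exo.A nq with hOdef
  set f : (Fin nq → Fin p → ℝ) →ₗ[ℝ] (Fin nq → Fin p → ℝ) := windowShift nq p + b ∘ₗ Φ with hf
  have hOa : ∀ x j, O x j = (exo.C * exo.A ^ j.val) *ᵥ x := fun x j => rfl
  have hOinj : Function.Injective O := LinearMap.ker_eq_bot.1 (LinearMap.ker_eq_bot'.2 fun x hx =>
    hO x fun l hl => congrFun hx ⟨l, hl⟩)
  have hfs : ∀ x (j : Fin nq) (h : j.val + 1 < nq), f x j = x ⟨j.val + 1, h⟩ := by
    intro x j h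
    have h1 : windowShift nq p x j = x ⟨j.val + 1, h⟩ := by
      simp only [windowShift, LinearMap.pi_apply]
      rw [dif_pos h]; rfl
    rw [hf, LinearMap.add_apply, Pi.add_apply, h1, hb, LinearMap.comp_apply,
      LinearMap.single_apply, Pi.single_eq_of_ne, add_zero]
    intro h2
    rw [h2] at h
    simp at h
    omega
  have hflast : ∀ x, f x ⟨nq - 1, by omega⟩ = Φ x := by
    intro x
    have h1 : windowShift nq p x ⟨nq - 1, by omega⟩ = 0 := by
      simp only [windowShift, LinearMap.pi_apply]
      rw [dif_neg (by omega)]; rfl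
    rw [hf, LinearMap.add_apply, Pi.add_apply, h1, hb, LinearMap.comp_apply,
      LinearMap.single_apply, Pi.single_eq_same, zero_add]
  have hfO : ∀ x, f (O x) = O (exo.A *ᵥ x) := by
    intro x
    funext j
    rw [hOa, Matrix.mulVec_mulVec, Matrix.mul_assoc, ← pow_succ]
    by_cases h : j.val + 1 < nq
    · rw [hfs _ _ h]; rfl
    · have hj : j = ⟨nq - 1, by omega⟩ := Fin.ext (by have := j.2; simp; omega)
      rw [hj, hflast, hΦ1]
      simp only [Nat.sub_add_cancel hnq]
  have hfk : ∀ k x (h : k < nq), (f ^ k) x ⟨0, hnq⟩ = x ⟨k, h⟩ := by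
    have : ∀ k i x (h : i + k < nq), (f ^ k) x ⟨i, by omega⟩ = x ⟨i + k, h⟩ := by
      intro k
      induction k with
      | zero => intro i x h; rfl
      | succ k ih =>
        intro i x h
        rw [pow_succ, Module.End.mul_apply, ih i (f x) (by omega), hfs _ _ (by simp; omega)]
        rfl
    intro k x h
    rw [this k 0 x (by omega)]
    congr 2
    omega
  have hfkO : ∀ k x, (f ^ k) (O x) = O ((exo.A ^ k) *ᵥ x) := by
    intro k
    induction k with
    | zero => simp
    | succ k ih =>
      intro x
      rw [pow_succ, Module.End.mul_apply, hfO, ih, Matrix.mulVec_mulVec, ← pow_succ]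
  -- matrices in a basis of the space of windows
  let E := (Module.finBasis ℝ (Fin nq → Fin p → ℝ)).equivFun
  let T : TargetModel p :=
    { n := Module.finrank ℝ (Fin nq → Fin p → ℝ)
      A := LinearMap.toMatrix' (E.conj f)
      B := LinearMap.toMatrix' (E.toLinearMap ∘ₗ b)
      C := LinearMap.toMatrix' (LinearMap.proj ⟨0, hnq⟩ ∘ₗ E.symm.toLinearMap) }
  have hA : ∀ k x, (T.A ^ k) *ᵥ (E x) = E ((f ^ k) x) := by
    intro k
    induction k with
    | zero => simp
    | succ k ih =>
      intro x
      rw [pow_succ, ← Matrix.mulVec_mulVec, LinearMap.toMatrix'_mulVec,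
        LinearEquiv.conj_apply_apply, E.symm_apply_apply, ih, pow_succ, Module.End.mul_apply]
  have hC : ∀ k x, (T.C * T.A ^ k) *ᵥ (E x) = (f ^ k) x ⟨0, hnq⟩ := by
    intro k x
    rw [← Matrix.mulVec_mulVec, hA, LinearMap.toMatrix'_mulVec, LinearMap.comp_apply,
      LinearEquiv.coe_coe, E.symm_apply_apply]
    rfl
  have hCB : ∀ k (h : k < nq) u, (T.C * T.A ^ k * T.B) *ᵥ u = b u ⟨k, h⟩ := by
    intro k h u
    rw [← Matrix.mulVec_mulVec, LinearMap.toMatrix'_mulVec, LinearMap.comp_apply,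
      LinearEquiv.coe_coe, hC, hfk]
  have hur : UniformRank T.C T.A T.B nq := by
    refine ⟨hnq, fun k hk => ?_, ?_⟩
    · refine Matrix.ext_of_mulVec_single fun i => ?_
      rw [hCB k (by omega), hb, LinearMap.single_apply, Pi.single_eq_of_ne, Matrix.zero_mulVec]
      intro h2
      have := congrArg Fin.val h2
      simp at this
      omega
    · have : T.C * T.A ^ (nq - 1) * T.B = 1 := by
        refine Matrix.ext_of_mulVec_single fun i => ?_
        rw [hCB _ (by omega), hb, LinearMap.single_apply, Pi.single_eq_same, Matrix.one_mulVec]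
      rw [this]
      exact isUnit_one
  have hob : ObservableIn T.C T.A nq := by
    intro x hx
    obtain ⟨x, rfl⟩ := E.surjective x
    have : x = 0 := funext fun j => by
      rw [← hfk j.val x j.2, ← hC, hx _ j.2]
      rfl
    rw [this, map_zero]
  obtain ⟨R, hR⟩ := hur.exists_transferMatrix_inverse hob
  refine ⟨T, fun x₀ => ⟨E (O x₀), fun k => ?_⟩, ⟨R, mul_eq_one_comm.1 hR⟩, ⟨R, hR⟩, hur,
    fun z => hur.not_isInvariantZero hob z, ?_⟩
  · rw [hC, hfkO, hOa, Matrix.mulVec_mulVec]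
    simp
  · obtain ⟨l, hl⟩ := exists_charpoly_eq_mul_X_pow f exo.A.mulVecLin O hOinj hfO nq hΦ2
    refine ⟨l, ?_⟩
    rw [Matrix.charpoly_mulVecLin] at hl
    rw [← hl, ← LinearEquiv.charpoly_conj E f, ← Matrix.charpoly_toLin' T.A,
      Matrix.toLin'_toMatrix']

/-! ### Synchronization -/

theorem IsSchur.tendsto_zero_of_eventually {n : ℕ} {M : Matrix (Fin n) (Fin n) ℝ} (hM : IsSchur M)
    {s w : ℤ → Fin n → ℝ} (hs : ∀ᶠ k in atTop, s (k + 1) = M *ᵥ s k + w k)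
    (hw : Tendsto w atTop (𝓝 0)) : Tendsto s atTop (𝓝 0) := by
  obtain ⟨k₀, hk₀⟩ := eventually_atTop.1 hs
  have hcast : Tendsto (fun n : ℕ => (n : ℤ) + k₀) atTop atTop :=
    tendsto_atTop_add_const_right _ _ tendsto_natCast_atTop_atTop
  have h1 := hM.tendsto_zero (s := fun n => s ((n : ℤ) + k₀)) (w := fun n => w ((n : ℤ) + k₀))
    (fun n => by
      rw [← hk₀ _ (by omega)]
      congr 1
      push_cast
      ring) (hw.comp hcast)
  have h2 : Tendsto (fun k : ℤ => s (k + k₀)) atTop (𝓝 0) := by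
    rw [← Nat.map_cast_int_atTop, tendsto_map'_iff]
    exact h1
  have h3 := h2.comp (tendsto_atTop_add_const_right atTop (-k₀) tendsto_id)
  simpa [Function.comp_def] using h3

theorem tendsto_zero_mulVec {α : Type*} {l : Filter α} {m n : ℕ} (M : Matrix (Fin m) (Fin n) ℝ)
    {s : α → Fin n → ℝ} (hs : Tendsto s l (𝓝 0)) : Tendsto (fun k => M *ᵥ s k) l (𝓝 0) := by
  have : Continuous fun x : Fin n → ℝ => M *ᵥ x := Continuous.matrix_mulVec continuous_const continuous_id
  simpa [Function.comp_def] using (this.tendsto 0).comp hs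

/-- A damped target model is Schur stable, as its eigenvalues lie on the unit circle or vanish. -/
theorem TargetModel.Remodels.isSchur_smul {p nq : ℕ} {exo : Exosystem p} {T : TargetModel p}
    (hT : T.Remodels exo nq) (hexo : exo.Admissible) {c : ℝ} (hc0 : 0 < c) (hc1 : c < 1) :
    IsSchur (c • T.A) := by
  intro z hz
  have hcC : (c : ℂ) ≠ 0 := by exact_mod_cast hc0.ne'
  have h1 : (c • T.A).map (algebraMap ℝ ℂ) = Units.mk0 (c : ℂ) hcC • T.A.map (algebraMap ℝ ℂ) := by
    ext i j
    simp [Units.smul_def]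
  rw [h1, spectrum.unit_smul_eq_smul] at hz
  obtain ⟨w, hw, rfl⟩ := hz
  have hw1 : ‖w‖ ≤ 1 := by
    obtain ⟨l, hl⟩ := hT.eigenvalues
    rw [Matrix.mem_spectrum_iff_isRoot_charpoly, Matrix.charpoly_map, hl, Polynomial.map_mul,
      Polynomial.map_pow, Polynomial.map_X, Polynomial.IsRoot, Polynomial.eval_mul,
      Polynomial.eval_pow, Polynomial.eval_X, mul_eq_zero] at hw
    rcases hw with hw | hw
    · refine (hexo.unitCircle w ?_).le
      rw [Matrix.mem_spectrum_iff_isRoot_charpoly, Matrix.charpoly_map]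
      exact hw
    · rw [eq_zero_of_pow_eq_zero hw]; simp
  simp only [Units.val_mk0, smul_eq_mul, norm_mul, Complex.norm_real,
    Real.norm_eq_abs, abs_of_pos hc0]
  nlinarith [norm_nonneg w]

/-- The error dynamics of one agent. Here `xb` is the synchronization error of the agent, `xo` the
estimate `x̂`, and `pd`, `qd` are the delayed synchronization error and protocol variable of its
parent. The errors `c (xb - pd) - xo` and `xb - χ`, and then `xb` itself, are states of Schur stable
systems with vanishing inputs. -/
theorem tendsto_zero_of_error_dynamics {n p : ℕ} {A : Matrix (Fin n) (Fin n) ℝ}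
    {B : Matrix (Fin n) (Fin p) ℝ} {C : Matrix (Fin p) (Fin n) ℝ} {K : Matrix (Fin p) (Fin n) ℝ}
    {H : Matrix (Fin n) (Fin p) ℝ} {c : ℝ} (hH : IsSchur (A - H * C)) (hK : IsSchur (A - B * K))
    (hA : IsSchur ((1 - c) • A)) {xb xo χ pd qd : ℤ → Fin n → ℝ} {ρ : ℤ → Fin p → ℝ}
    (hρ : Tendsto ρ atTop (𝓝 0)) (hpd : Tendsto pd atTop (𝓝 0)) (hqd : Tendsto qd atTop (𝓝 0))
    (hxb : ∀ᶠ k in atTop, xb (k + 1) = A *ᵥ xb k + B *ᵥ (-(K *ᵥ χ k) + ρ k))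
    (hxo : ∀ᶠ k in atTop, xo (k + 1) = A *ᵥ xo k - (B * K) *ᵥ (c • (χ k - qd k)) +
      H *ᵥ (c • (C *ᵥ xb k - C *ᵥ pd k) - C *ᵥ xo k))
    (hχ : ∀ᶠ k in atTop, χ (k + 1) = (A - B * K) *ᵥ χ k + A *ᵥ xo k - A *ᵥ (c • (χ k - qd k))) :
    Tendsto xb atTop (𝓝 0) ∧ Tendsto χ atTop (𝓝 0) := by
  have hpd1 : Tendsto (fun k : ℤ => pd (k + 1)) atTop (𝓝 0) :=
    hpd.comp (tendsto_atTop_add_const_right _ _ tendsto_id)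
  have he : Tendsto (fun k => c • (xb k - pd k) - xo k) atTop (𝓝 0) := by
    refine hH.tendsto_zero_of_eventually (w := fun k => c • (A *ᵥ pd k) - c • pd (k + 1) -
      c • ((B * K) *ᵥ qd k) + c • (B *ᵥ ρ k)) ?_ ?_
    · filter_upwards [hxb, hxo] with k h1 h2
      rw [h1, h2]
      simp only [Matrix.mulVec_add, Matrix.mulVec_sub, Matrix.sub_mulVec, Matrix.mulVec_smul,
        Matrix.mulVec_neg, ← Matrix.mulVec_mulVec]
      module
    · simpa using ((((tendsto_zero_mulVec A hpd).const_smul c).sub (hpd1.const_smul c)).sub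
        ((tendsto_zero_mulVec (B * K) hqd).const_smul c)).add
          ((tendsto_zero_mulVec B hρ).const_smul c)
  have hδ : Tendsto (fun k => xb k - χ k) atTop (𝓝 0) := by
    refine hA.tendsto_zero_of_eventually (w := fun k => A *ᵥ (c • (xb k - pd k) - xo k) +
      c • (A *ᵥ pd k) - c • (A *ᵥ qd k) + B *ᵥ ρ k) ?_ ?_
    · filter_upwards [hxb, hχ] with k h1 h2
      rw [h1, h2]
      simp only [Matrix.mulVec_add, Matrix.mulVec_sub, Matrix.sub_mulVec, Matrix.mulVec_smul,
        Matrix.mulVec_neg, ← Matrix.mulVec_mulVec, Matrix.smul_mulVec]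
      module
    · simpa using (((tendsto_zero_mulVec A he).add ((tendsto_zero_mulVec A hpd).const_smul c)).sub
        ((tendsto_zero_mulVec A hqd).const_smul c)).add (tendsto_zero_mulVec B hρ)
  have hx : Tendsto xb atTop (𝓝 0) := by
    refine hK.tendsto_zero_of_eventually (w := fun k => (B * K) *ᵥ (xb k - χ k) + B *ᵥ ρ k) ?_ ?_
    · filter_upwards [hxb] with k h1
      rw [h1]
      simp only [Matrix.mulVec_add, Matrix.mulVec_sub, Matrix.sub_mulVec, Matrix.mulVec_neg,
        ← Matrix.mulVec_mulVec]
      module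
    · simpa using (tendsto_zero_mulVec (B * K) hδ).add (tendsto_zero_mulVec B hρ)
  exact ⟨hx, by simpa using hx.sub hδ⟩

section Tree

variable {N : ℕ} {G : Network N}

theorem IsTreeGraph.lt_of_pos (h : IsTreeGraph G.a) {i j : Fin N} (hij : 0 < G.a i j) : j < i := by
  rcases lt_trichotomy i j with h1 | rfl | h1
  · have := h.lowerTriangular i j h1
    simp only [laplacian, Matrix.of_apply, if_neg h1.ne, neg_eq_zero] at this
    exact absurd this hij.ne'
  · exact absurd (h.no_loops i) hij.ne'
  · exact h1

theorem IsTreeGraph.eq_zero_of_root (h : IsTreeGraph G.a) {i : Fin N} (hi : i.val = 0)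
    (j : Fin N) : G.a i j = 0 := by
  by_contra hne
  have := Fin.lt_def.1 (h.lt_of_pos (lt_of_le_of_ne (h.nonneg i j) (Ne.symm hne)))
  omega

theorem IsTreeGraph.eq_zero_of_ne_parent (h : IsTreeGraph G.a) {i j : Fin N}
    (hi : i.val ≠ 0) (hij : 0 < G.a i j) {l : Fin N} (hl : l ≠ j) : G.a i l = 0 := by
  by_contra hne
  exact hl ((h.parent i hi).unique (lt_of_le_of_ne (h.nonneg i l) (Ne.symm hne)) hij)

theorem IsTreeGraph.delayFromExo_eq (h : IsTreeGraph G.a) {i j : Fin N} (hi : i.val ≠ 0)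
    (hij : 0 < G.a i j) : G.delayFromExo i = G.κ i j + G.delayFromExo j := by
  rw [Network.delayFromExo, if_neg hi, Finset.sum_eq_single j]
  · rw [dif_pos ⟨h.lt_of_pos hij, hij⟩]
  · intro l _ hl
    rw [dif_neg]
    rintro ⟨-, h2⟩
    exact h2.ne' (h.eq_zero_of_ne_parent hi hij hl)
  · simp

theorem delayFromExo_root {i : Fin N} (hi : i.val = 0) : G.delayFromExo i = G.κroot := by
  rw [Network.delayFromExo, if_pos hi]

theorem IsTreeGraph.zetaBar_root (h : IsTreeGraph G.a) {i : Fin N} (hi : i.val = 0) {p : ℕ}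
    (y : Fin N → ℤ → Fin p → ℝ) (yr : ℤ → Fin p → ℝ) (k : ℤ) :
    G.zetaBar y yr i k = (1 / 2 : ℝ) • (y i k - yr (k - G.κroot)) := by
  simp [Network.zetaBar, Network.inDegree, h.eq_zero_of_root hi, rootIndicator, hi]

theorem IsTreeGraph.zetaHat_root (h : IsTreeGraph G.a) {i : Fin N} (hi : i.val = 0) {d : ℕ}
    (ξ : Fin N → ℤ → Fin d → ℝ) (k : ℤ) : G.zetaHat ξ i k = (1 / 2 : ℝ) • ξ i k := by
  simp [Network.zetaHat, Network.inDegree, h.eq_zero_of_root hi, rootIndicator, hi]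

theorem IsTreeGraph.zetaBar_eq (h : IsTreeGraph G.a) {i j : Fin N} (hi : i.val ≠ 0)
    (hij : 0 < G.a i j) {p : ℕ} (y : Fin N → ℤ → Fin p → ℝ) (yr : ℤ → Fin p → ℝ) (k : ℤ) :
    G.zetaBar y yr i k = (G.a i j / (2 + G.a i j)) • (y i k - y j (k - G.κ i j)) := by
  have h1 : G.inDegree i = G.a i j := Finset.sum_eq_single j
    (fun l _ hl => h.eq_zero_of_ne_parent hi hij hl) (by simp)
  rw [Network.zetaBar, h1, Finset.sum_eq_single j
    (fun l _ hl => by rw [h.eq_zero_of_ne_parent hi hij hl, zero_smul]) (by simp)]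
  simp [rootIndicator, hi, smul_smul, div_eq_inv_mul]

theorem IsTreeGraph.zetaHat_eq (h : IsTreeGraph G.a) {i j : Fin N} (hi : i.val ≠ 0)
    (hij : 0 < G.a i j) {d : ℕ} (ξ : Fin N → ℤ → Fin d → ℝ) (k : ℤ) :
    G.zetaHat ξ i k = (G.a i j / (2 + G.a i j)) • (ξ i k - ξ j (k - G.κhat i j)) := by
  have h1 : G.inDegree i = G.a i j := Finset.sum_eq_single j
    (fun l _ hl => h.eq_zero_of_ne_parent hi hij hl) (by simp)
  rw [Network.zetaHat, h1, Finset.sum_eq_single j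
    (fun l _ hl => by rw [h.eq_zero_of_ne_parent hi hij hl, zero_smul]) (by simp)]
  simp [rootIndicator, hi, smul_smul, div_eq_inv_mul]

end Tree

theorem tendsto_sub_natCast (m : ℕ) : Tendsto (fun k : ℤ => k - (m : ℤ)) atTop atTop := by
  simpa [sub_eq_add_neg] using tendsto_atTop_add_const_right atTop (-(m : ℤ)) tendsto_id

/-- Synchronization, by induction along the tree: the errors of the root vanish, and those of any
other agent vanish if the delayed ones of its parent do. -/
theorem solves_finalProtocol {p nq : ℕ} {ι : Type} {exo : Exosystem p} (hexo : exo.Admissible)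
    {ag : ι → Agent p} {T : TargetModel p} (hT : T.Remodels exo nq)
    {c : ∀ t, PreCompensator (ag t)} (hc : ∀ t, (c t).Homogenizes T)
    {H : Matrix (Fin T.n) (Fin p) ℝ} (hH : IsSchur (T.A - H * T.C))
    {K : Matrix (Fin p) (Fin T.n) ℝ} (hK : IsSchur (T.A - T.B * K)) :
    SolvesDelayedOutputSync exo ag (fun t => Fin (c t).n ⊕ (Fin T.n ⊕ Fin T.n))
      (fun t => finalProtocol T (c t) K H) := by
  intro N s G hG xr x u xc yr y ξ tr
  set ξh : ∀ i, ℤ → Fin (c (s i)).n → ℝ := fun i k a => xc i k (Sum.inl a) with hξh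
  set xo : Fin N → ℤ → Fin T.n → ℝ := fun i k a => xc i k (Sum.inr (Sum.inl a)) with hxo
  set χ : Fin N → ℤ → Fin T.n → ℝ := fun i k a => xc i k (Sum.inr (Sum.inr a)) with hχ
  have hxc : ∀ i k, xc i k = Sum.elim (ξh i k) (Sum.elim (xo i k) (χ i k)) := by
    intro i k
    ext (a | a | a) <;> rfl
  have hstate := tr.protocolState
  simp only [finalProtocol, hxc, Matrix.fromBlocks_mulVec, Matrix.fromRows_mulVec,
    Matrix.fromCols_mulVec, Sum.elim_comp_inl, Sum.elim_comp_inr, Matrix.zero_mulVec, zero_add,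
    add_zero, ← Sum.elim_add_add, Sum.elim_eq_iff] at hstate
  have hinput := tr.input
  simp only [finalProtocol, hxc, Matrix.fromCols_mulVec, Sum.elim_comp_inl, Sum.elim_comp_inr,
    Matrix.zero_mulVec, zero_add, add_zero, Matrix.neg_mulVec, ← Matrix.mulVec_mulVec] at hinput
  have hξ : ∀ i, ∀ k : ℤ, 0 ≤ k → ξ i k = χ i k := by
    intro i k hk
    rw [tr.transmitted i k hk]
    simp [finalProtocol, hxc, Matrix.fromCols_mulVec]
  -- the reference signal as an output of the target model
  obtain ⟨w₀, hw₀⟩ := hT.sameOutputs (xr 0)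
  set xt : ℤ → Fin T.n → ℝ := fun k => (T.A ^ k.toNat) *ᵥ w₀ with hxt
  have hxt1 : ∀ k : ℤ, 0 ≤ k → xt (k + 1) = T.A *ᵥ xt k := by
    intro k hk
    simp only [hxt]
    rw [Int.toNat_add hk (by norm_num), Matrix.mulVec_mulVec]
    simp [pow_succ']
  have hxr : ∀ k : ℕ, xr k = (exo.A ^ k) *ᵥ xr 0 := by
    intro k
    induction k with
    | zero => simp
    | succ k ih =>
      push_cast
      rw [tr.exoState k (by omega), ih, Matrix.mulVec_mulVec, ← pow_succ']
  have hyr : ∀ k : ℤ, 0 ≤ k → yr k = T.C *ᵥ xt k := by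
    intro k hk
    obtain ⟨k, rfl⟩ := Int.eq_ofNat_of_zero_le hk
    rw [tr.exoOutput _ hk, hxr]
    simp only [hxt, Int.toNat_natCast]
    rw [Matrix.mulVec_mulVec, Matrix.mulVec_mulVec, hw₀]
  -- the compensated agents as target models with a vanishing disturbance
  have hagent : ∀ i, ∃ (xh : ℤ → Fin T.n → ℝ) (ρ : ℤ → Fin p → ℝ), Tendsto ρ atTop (𝓝 0) ∧
      (∀ k : ℤ, 0 ≤ k → xh (k + 1) = T.A *ᵥ xh k + T.B *ᵥ (-(K *ᵥ χ i k) + ρ k)) ∧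
      ∀ k : ℤ, 0 ≤ k → y i k = T.C *ᵥ xh k := by
    intro i
    obtain ⟨ns, As, Cs, hAs, hom⟩ := hc (s i)
    obtain ⟨xh, ω, h1, h2, h3⟩ := hom (fun k => x i k) (fun k => ξh i k)
      (fun k => -(K *ᵥ χ i k)) (fun k => by
        push_cast
        rw [tr.state i k (by omega), hinput i k (by omega), Matrix.mulVec_neg]) (fun k => by
        push_cast
        rw [(hstate i k (by omega)).1, Matrix.mulVec_neg, Matrix.neg_mulVec,
          ← Matrix.mulVec_mulVec (M := (c (s i)).Eh)]
        abel)
    have hω : Tendsto (fun k : ℤ => ω k.toNat) atTop (𝓝 0) := by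
      refine hAs.tendsto_zero_of_eventually (w := 0) ?_ tendsto_const_nhds
      filter_upwards [eventually_ge_atTop 0] with k hk
      rw [Int.toNat_add hk (by norm_num)]
      simp [h2]
    refine ⟨fun k => xh k.toNat, fun k => Cs *ᵥ ω k.toNat, tendsto_zero_mulVec Cs hω, ?_, ?_⟩
    · intro k hk
      obtain ⟨k, rfl⟩ := Int.eq_ofNat_of_zero_le hk
      exact h1 k
    · intro k hk
      obtain ⟨k, rfl⟩ := Int.eq_ofNat_of_zero_le hk
      rw [tr.output i _ hk]
      exact h3 k
  choose xh ρ hρ hxh hy using hagent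
  set xb : Fin N → ℤ → Fin T.n → ℝ := fun i k => xh i k - xt (k - G.delayFromExo i) with hxb
  have hyb : ∀ i, ∀ᶠ k : ℤ in atTop, y i k - yr (k - G.delayFromExo i) = T.C *ᵥ xb i k := by
    intro i
    filter_upwards [eventually_ge_atTop 0,
      (tendsto_sub_natCast (G.delayFromExo i)).eventually (eventually_ge_atTop 0)] with k h1 h2
    rw [hy i k h1, hyr _ h2, Matrix.mulVec_sub]
  have hxb1 : ∀ i, ∀ᶠ k : ℤ in atTop,
      xb i (k + 1) = T.A *ᵥ xb i k + T.B *ᵥ (-(K *ᵥ χ i k) + ρ i k) := by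
    intro i
    filter_upwards [eventually_ge_atTop 0,
      (tendsto_sub_natCast (G.delayFromExo i)).eventually (eventually_ge_atTop 0)] with k h1 h2
    simp only [hxb]
    rw [hxh i k h1, show k + 1 - (G.delayFromExo i : ℤ) = k - G.delayFromExo i + 1 by ring,
      hxt1 _ h2, Matrix.mulVec_sub]
    abel
  -- one step of the induction, for any signals of the parent that vanish
  have hstep : ∀ (i : Fin N) (γ : ℝ) (pd qd : ℤ → Fin T.n → ℝ), 0 < γ → γ < 1 →
      Tendsto pd atTop (𝓝 0) → Tendsto qd atTop (𝓝 0) →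
      (∀ᶠ k in atTop, G.zetaBar y yr i k = γ • (T.C *ᵥ xb i k - T.C *ᵥ pd k)) →
      (∀ᶠ k in atTop, G.zetaHat ξ i k = γ • (χ i k - qd k)) →
      Tendsto (xb i) atTop (𝓝 0) ∧ Tendsto (χ i) atTop (𝓝 0) := by
    intro i γ pd qd hγ0 hγ1 hpd hqd hbar hhat
    refine tendsto_zero_of_error_dynamics (xo := xo i) hH hK
      (hT.isSchur_smul hexo (sub_pos.2 hγ1) (by linarith)) (hρ i) hpd hqd (hxb1 i) ?_ ?_
    · filter_upwards [eventually_ge_atTop 0, hbar, hhat] with k h1 h2 h3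
      rw [(hstate i k h1).2.1, h2, h3, Matrix.mulVec_sub H, Matrix.sub_mulVec, Matrix.neg_mulVec,
        ← Matrix.mulVec_mulVec (M := H)]
      abel
    · filter_upwards [eventually_ge_atTop 0, hhat] with k h1 h3
      rw [(hstate i k h1).2.2, h3, Matrix.neg_mulVec]
      abel
  have key : ∀ (m : ℕ) (i : Fin N), i.val = m →
      Tendsto (xb i) atTop (𝓝 0) ∧ Tendsto (χ i) atTop (𝓝 0) := by
    intro m
    induction m using Nat.strong_induction_on with
    | _ m ih =>
      intro i him
      by_cases hi : i.val = 0
      · refine hstep i (1 / 2) 0 0 (by norm_num) (by norm_num) tendsto_const_nhds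
          tendsto_const_nhds ?_ ?_
        · filter_upwards [hyb i] with k hk
          rw [hG.zetaBar_root hi, ← hk, delayFromExo_root hi, Pi.zero_apply, Matrix.mulVec_zero,
            sub_zero]
        · filter_upwards [eventually_ge_atTop 0] with k hk
          rw [hG.zetaHat_root hi, hξ i k hk, Pi.zero_apply, sub_zero]
      · obtain ⟨j, hij, -⟩ := hG.parent i hi
        obtain ⟨hj1, hj2⟩ := ih j.val (him ▸ Fin.lt_def.1 (hG.lt_of_pos hij)) j rfl
        refine hstep i (G.a i j / (2 + G.a i j)) (fun k => xb j (k - G.κ i j))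
          (fun k => χ j (k - G.κhat i j)) (by positivity) ?_
          (hj1.comp (tendsto_sub_natCast _)) (hj2.comp (tendsto_sub_natCast _)) ?_ ?_
        · rw [div_lt_one (by positivity)]; linarith
        · filter_upwards [hyb i, (tendsto_sub_natCast (G.κ i j)).eventually (hyb j)] with k h1 h2
          rw [hG.zetaBar_eq hi hij, ← h1, ← h2, hG.delayFromExo_eq hi hij]
          congr 1
          rw [show k - (G.κ i j : ℤ) - (G.delayFromExo j : ℤ) =
            k - ((G.κ i j + G.delayFromExo j : ℕ) : ℤ) by push_cast; ring]
          abel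
        · filter_upwards [eventually_ge_atTop 0,
            (tendsto_sub_natCast (G.κhat i j)).eventually (eventually_ge_atTop 0)] with k h1 h2
          rw [hG.zetaHat_eq hi hij, hξ i k h1, hξ j _ h2]
  intro i
  exact (tendsto_zero_mulVec T.C (key i.val i rfl).1).congr' ((hyb i).mono fun k hk => hk.symm)

/-- Solvability does not depend on the index types of the protocol states. -/
theorem SolvesDelayedOutputSync.solvable {p d : ℕ} {ι : Type} {exo : Exosystem p}
    {ag : ι → Agent p} {σ : ι → Type} [∀ t, Fintype (σ t)]
    {P : ∀ t, Protocol (σ t) p (ag t).m (ag t).q d} (h : SolvesDelayedOutputSync exo ag σ P) :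
    DelayedOutputSyncSolvable exo ag := by
  let e : ∀ t, σ t ≃ Fin (Fintype.card (σ t)) := fun t => Fintype.equivFin (σ t)
  refine ⟨d, fun t => Fintype.card (σ t), fun t =>
    { A := (P t).A.submatrix (e t).symm (e t).symm
      B := (P t).B.submatrix (e t).symm id
      C := (P t).C.submatrix (e t).symm id
      D := (P t).D.submatrix (e t).symm id
      E := (P t).E.submatrix id (e t).symm
      F := (P t).F
      G := (P t).G
      H := (P t).H
      X := (P t).X.submatrix id (e t).symm }, ?_⟩
  intro N s G hG xr x u xc yr y ξ tr
  refine h N s G hG xr x u (fun i k => xc i k ∘ e (s i)) yr y ξ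
    ⟨tr.exoState, tr.exoOutput, tr.state, tr.output, fun i k hk => ?_, fun i k hk => ?_,
      fun i k hk => ?_⟩
  · funext a
    have h1 := congrFun (tr.protocolState i k hk) (e (s i) a)
    simp only [Matrix.submatrix_mulVec_equiv, Pi.add_apply, Function.comp_apply] at h1 ⊢
    rw [h1]
    simp [Matrix.mulVec, dotProduct]
  · rw [tr.input i k hk]
    simp [Matrix.submatrix_mulVec_equiv]
  · rw [tr.transmitted i k hk]
    simp [Matrix.submatrix_mulVec_equiv]

/-- Admissible ranks exist: the delays of right inverses bound the orders of the infinite zeros. -/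
theorem exists_isAdmissibleRank {p : ℕ} {ι : Type} [Finite ι] (exo : Exosystem p)
    {ag : ι → Agent p} (hag : ∀ t, (ag t).Admissible) : ∃ nq, IsAdmissibleRank exo ag nq := by
  choose M P hP using fun t => (hag t).rightInvertible.exists_expansion_mul
  obtain ⟨b, hb⟩ := Set.finite_range M |>.bddAbove
  refine ⟨max 1 (max b (observabilityIndex exo.C exo.A)), le_max_left _ _, fun t q hq => ?_, ?_⟩
  · have h1 := hq.le_of_expansion_mul (hP t)
    have h2 : M t ≤ b := hb ⟨t, rfl⟩
    omega
  · omega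

end DelayedSync

open DelayedSync
theorem theorem3 {p : ℕ} {ι : Type} [Finite ι] (exo : Exosystem p) (hexo : exo.Admissible)
    (ag : ι → Agent p) (hag : ∀ t, (ag t).Admissible) :
    DelayedOutputSyncSolvable exo ag ∧
    (∃ nq, IsAdmissibleRank exo ag nq) ∧
    ∀ nq, IsAdmissibleRank exo ag nq →
      (∃ T : TargetModel p, T.Remodels exo nq) ∧
      ∀ T : TargetModel p, T.Remodels exo nq →
        (∀ t, ∃ c : PreCompensator (ag t), c.Homogenizes T) ∧
        (∃ H : Matrix (Fin T.n) (Fin p) ℝ, IsSchur (T.A - H * T.C)) ∧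
        (∃ K : Matrix (Fin p) (Fin T.n) ℝ, IsSchur (T.A - T.B * K)) ∧
        ∀ c : (∀ t, PreCompensator (ag t)), (∀ t, (c t).Homogenizes T) →
        ∀ H : Matrix (Fin T.n) (Fin p) ℝ, IsSchur (T.A - H * T.C) →
        ∀ K : Matrix (Fin p) (Fin T.n) ℝ, IsSchur (T.A - T.B * K) →
          SolvesDelayedOutputSync exo ag (fun t => Fin (c t).n ⊕ (Fin T.n ⊕ Fin T.n))
            (fun t => finalProtocol T (c t) K H) := by
  have hT : ∀ nq, IsAdmissibleRank exo ag nq → ∃ T : TargetModel p, T.Remodels exo nq :=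
    fun nq h => exists_remodels h.pos
      (hexo.observable.observableIn_of_index_le h.observabilityIndices)
  have hob : ∀ {nq} {T : TargetModel p}, T.Remodels exo nq → ObservableIn T.C T.A nq :=
    fun hT => hT.uniformRank.observableIn hT.noInvariantZero
  have hc : ∀ nq, IsAdmissibleRank exo ag nq → ∀ T : TargetModel p, T.Remodels exo nq →
      ∀ t, ∃ c : PreCompensator (ag t), c.Homogenizes T := fun nq h T hT t =>
    exists_homogenizes (hag t) (h.infiniteZeros t) hT.uniformRank (hob hT)
  refine ⟨?_, exists_isAdmissibleRank exo hag, fun nq h => ⟨hT nq h, fun T hTr =>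
    ⟨hc nq h T hTr, hTr.uniformRank.exists_injection (hob hTr),
      hTr.uniformRank.exists_feedback (hob hTr), fun c hhom H hH K hK =>
        solves_finalProtocol hexo hTr hhom hH hK⟩⟩⟩
  obtain ⟨nq, h⟩ := exists_isAdmissibleRank exo hag
  obtain ⟨T, hTr⟩ := hT nq h
  choose c hhom using hc nq h T hTr
  obtain ⟨H, hH⟩ := hTr.uniformRank.exists_injection (hob hTr)
  obtain ⟨K, hK⟩ := hTr.uniformRank.exists_feedback (hob hTr)
  exact (solves_finalProtocol hexo hTr hhom hH hK).solvable
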